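/- Let $J>3$ be an integer, $\alpha\in(0,1)$, and let $G_0$ be a probability distribution on $\mathbb{R}\times(0,\infty)$. For $i=1,\dots,n$ and $j=1,\dots,J$ let $$y_{ij}=\mu_i+\sigma_i\epsilon_{ij},\qquad \epsilon_{ij}\mid(\mu_l,\sigma_l)_{l\le n}\sim_{iid}N(0,1),\qquad (\mu_i,\sigma_i)\sim_{iid}G_0,$$ and put $\mathcal Y=(y_{ij})_{i,j}$, $y_i=\frac1J\sum_j y_{ij}$, $s_i^2=\frac1{J-1}\sum_j(y_{ij}-y_i)^2$, $k=\frac12(J-1)$. Let $q_{\alpha,i}$ be the $\alpha$-quantile of $N(\mu_i,\sigma_i^2)$, and let $\Phi$ be the standard normal distribution function. Let $R_{G_0}(\hat q,q_\alpha)=\mathbb{E}\big[\frac1n\sum_{i=1}^n(\hat q_i(\mathcal Y)-q_{\alpha,i})^2\big]\in[0,\infty]$ for Borel maps $\hat q:\mathbb{R}^{n\times J}\to\mathbb{R}^n$. Write $\mathbb{E}_{G_0}[\,\cdot\mid y,s]$ for the expectation under the conditional distribution of $(\mu_i,\sigma_i)$ given $(y_i,s_i)=(y,s)$, and let $$f_{G_0}(y,v)=\int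 \varphi\big(y;\mu,\tfrac{\sigma^2}{J}\big)\,\gamma\big(v;k,\tfrac{\sigma^2}{k}\big)\,dG_0(\mu,\sigma),$$ where $\varphi(\cdot;m,w)$ is the density of $N(m,w)$ and $\gamma(\cdot;k,b)$ is the gamma density with shape $k$ and scale $b$. Then: 1. $q_{\alpha,i}=\mu_i+\sigma_i\Phi^{-1}(\alpha)$ (almost surely), and the posterior means $\mathbb{E}_{G_0}[\mu\mid y,s]$ and $\mathbb{E}_{G_0}[\sigma\mid y,s]$ exist for almost every $(y,s)\in\mathbb{R}\times(0,\infty)$. 2. For every $n$ the estimator $$\hat q^*_{\alpha,i}=\mathbb{E}_{G_0}[\mu\mid y_i,s_i]+\mathbb{E}_{G_0}[\sigma\mid y_i,s_i]\,\Phi^{-1}(\alpha),\qquad i=1,\dots,n,$$ minimizes $R_{G_0}(\hat q,q_\alpha)$ over all Borel maps $\hat q$; if the minimal risk is finite, every minimizer equals $\hat q^*_\alpha$ almost surely. 3. $f_{G_0}$ is a density of $(y_i,s_i^2)$, and $\hat q^*_\alpha$ depends on $G_0$ only through $f_{G_0}$. Explicitly, with $f=f_{G_0}$, for almost every $(y,s)\in\mathbb{R}\times(0,\infty)$,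 $$\mathbb{E}_{G_0}[\mu\mid y,s]+\mathbb{E}_{G_0}[\sigma\mid y,s]\,\Phi^{-1}(\alpha)=y+\frac{V(y,s^2)}{J}\,\partial_y\log f(y,s^2)+\frac1J\,\partial_yV(y,s^2)+S(y,s^2)\,\Phi^{-1}(\alpha),$$ where $$V(y,v)=k\int_v^\infty\Big[\frac vt\Big]^{k-1}\frac{f(y,t)}{f(y,v)}\,dt,\qquad S(y,v)=\frac{k}{\Gamma(1/2)}\int_v^\infty\frac{1}{\sqrt{k(t-v)}}\Big[\frac vt\Big]^{k-1}\frac{f(y,t)}{f(y,v)}\,dt .$$ Here $f(y,v)>0$, $f$ and $V$ are differentiable in $y$, and both integrals converge for all $y\in\mathbb{R}$, $v>0$. In particular, if $f_{G_0}=f_{G_0'}$ on $\mathbb{R}\times(0,\infty)$ for another prior $G_0'$, then the estimators for $G_0$ and $G_0'$ coincide for almost every $(y,s)\in\mathbb{R}\times(0,\infty)$. -/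

import Mathlib

open MeasureTheory ProbabilityTheory Set

namespace HeteroEB

/-- The `α`-quantile `inf {y : α ≤ Φ(y | μ, σ)}` of the normal distribution `N(μ, σ²)`. -/
noncomputable def normalQuantile (μ σ α : ℝ) : ℝ :=
  sInf {y : ℝ | α ≤ cdf (gaussianReal μ (σ ^ 2).toNNReal) y}

/-- `Φ⁻¹(α)`, the quantile function of the standard normal distribution. -/
noncomputable def stdNormalQuantile (α : ℝ) : ℝ := normalQuantile 0 1 α

/-- Sample mean of the `J` observations of one unit. -/
noncomputable def sampleMean {J : ℕ} (x : Fin J → ℝ) : ℝ := (1 / (J : ℝ)) * ∑ j, x j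

/-- Sample variance (with the factor `1 / (J - 1)`) of the `J` observations of one unit. -/
noncomputable def sampleVar {J : ℕ} (x : Fin J → ℝ) : ℝ :=
  (1 / ((J : ℝ) - 1)) * ∑ j, (x j - sampleMean x) ^ 2

/-- Sample standard deviation. -/
noncomputable def sampleSd {J : ℕ} (x : Fin J → ℝ) : ℝ := Real.sqrt (sampleVar x)

/-- Observations of one unit with parameter `θ = (μ, σ)` and noise `ε`: `y_j = μ + σ ε_j`. -/
def unitData {J : ℕ} (θ : ℝ × ℝ) (ε : Fin J → ℝ) : Fin J → ℝ := fun j => θ.1 + θ.2 * ε j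

/-- Law of the noise `(ε_1, …, ε_J)` of one unit: i.i.d. standard normal. -/
noncomputable def unitNoise (J : ℕ) : Measure (Fin J → ℝ) :=
  Measure.pi fun _ => gaussianReal 0 1

noncomputable instance (J : ℕ) : IsProbabilityMeasure (unitNoise J) := by
  unfold unitNoise; infer_instance

/-- Joint law of the parameter and the noise of one unit when `(μ, σ) ∼ G`. -/
noncomputable def unitLaw (J : ℕ) (G : Measure (ℝ × ℝ)) : Measure ((ℝ × ℝ) × (Fin J → ℝ)) :=
  G.prod (unitNoise J)

noncomputable instance (J : ℕ) (G : Measure (ℝ × ℝ)) [IsProbabilityMeasure G] :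
    IsProbabilityMeasure (unitLaw J G) := by
  unfold unitLaw; infer_instance

/-- Posterior: regular conditional distribution of `(μ, σ)` given the sample mean and the sample
standard deviation `(y, s)`, when `(μ, σ) ∼ G`. -/
noncomputable def posterior (J : ℕ) (G : Measure (ℝ × ℝ)) [IsProbabilityMeasure G] :
    Kernel (ℝ × ℝ) (ℝ × ℝ) :=
  condDistrib (fun ω : (ℝ × ℝ) × (Fin J → ℝ) => ω.1)
    (fun ω => (sampleMean (unitData ω.1 ω.2), sampleSd (unitData ω.1 ω.2))) (unitLaw J G)

/-- `E_G[μ | y, s]`. -/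
noncomputable def postMean (J : ℕ) (G : Measure (ℝ × ℝ)) [IsProbabilityMeasure G] (y s : ℝ) : ℝ :=
  ∫ θ, θ.1 ∂(posterior J G (y, s))

/-- `E_G[σ | y, s]`. -/
noncomputable def postSd (J : ℕ) (G : Measure (ℝ × ℝ)) [IsProbabilityMeasure G] (y s : ℝ) : ℝ :=
  ∫ θ, θ.2 ∂(posterior J G (y, s))

/-- `E_G[μ | y, s] + E_G[σ | y, s] Φ⁻¹(α)`. -/
noncomputable def postQuantile (J : ℕ) (G : Measure (ℝ × ℝ)) [IsProbabilityMeasure G]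
    (α y s : ℝ) : ℝ :=
  postMean J G y s + postSd J G y s * stdNormalQuantile α

/-- Full data set: `y_{ij} = μ_i + σ_i ε_{ij}`. -/
def observe {n J : ℕ} (θ : Fin n → ℝ × ℝ) (ε : Fin n → Fin J → ℝ) : Fin n → Fin J → ℝ :=
  fun i => unitData (θ i) (ε i)

/-- Law of the parameters `(μ_i, σ_i)`, `i = 1, …, n`: i.i.d. with law `G`. -/
noncomputable def paramLaw (n : ℕ) (G : Measure (ℝ × ℝ)) : Measure (Fin n → ℝ × ℝ) :=
  Measure.pi fun _ => G

/-- Law of the noise array `ε_{ij}`: i.i.d. standard normal. -/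
noncomputable def noiseLaw (n J : ℕ) : Measure (Fin n → Fin J → ℝ) :=
  Measure.pi fun _ => unitNoise J

/-- Marginal law of the full data set. -/
noncomputable def dataLaw (n J : ℕ) (G : Measure (ℝ × ℝ)) : Measure (Fin n → Fin J → ℝ) :=
  ((paramLaw n G).prod (noiseLaw n J)).map fun ω => observe ω.1 ω.2

/-- Average quadratic loss `(1/n) ∑ (a_i - b_i)²`. -/
noncomputable def loss {n : ℕ} (a b : Fin n → ℝ) : ℝ := (1 / (n : ℝ)) * ∑ i, (a i - b i) ^ 2

/-- Integrated risk, in `[0, ∞]`, of an estimator of the `α`-quantiles of the `n` units. -/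
noncomputable def risk {n J : ℕ} (G : Measure (ℝ × ℝ)) (α : ℝ)
    (est : (Fin n → Fin J → ℝ) → Fin n → ℝ) : ENNReal :=
  ∫⁻ θ, ∫⁻ ε, ENNReal.ofReal
    (loss (est (observe θ ε)) fun i => normalQuantile (θ i).1 (θ i).2 α)
    ∂(noiseLaw n J) ∂(paramLaw n G)

/-- `est` minimizes the integrated risk over all Borel maps from the data to `ℝⁿ`. -/
def IsRiskMinimizer {n J : ℕ} (G : Measure (ℝ × ℝ)) (α : ℝ)
    (est : (Fin n → Fin J → ℝ) → Fin n → ℝ) : Prop :=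
  Measurable est ∧
    ∀ est' : (Fin n → Fin J → ℝ) → Fin n → ℝ, Measurable est' → risk G α est ≤ risk G α est'

/-- The estimator `Y ↦ (E_G[μ | y_i, s_i] + E_G[σ | y_i, s_i] Φ⁻¹(α))_i`. -/
noncomputable def oracleQuantile (n J : ℕ) (G : Measure (ℝ × ℝ)) [IsProbabilityMeasure G]
    (α : ℝ) : (Fin n → Fin J → ℝ) → Fin n → ℝ :=
  fun Y i => postQuantile J G α (sampleMean (Y i)) (sampleSd (Y i))

/-- `k = (J - 1) / 2`. -/
noncomputable def shape (J : ℕ) : ℝ := ((J : ℝ) - 1) / 2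

/-- The mixture density `f_G(y, v)` of (sample mean, sample variance): the `G`-mixture of the
sampling densities of `N(μ, σ²/J)` at `y` and of the gamma law with shape `k` and
scale `σ²/k` at `v`. -/
noncomputable def mixtureDensity (J : ℕ) (G : Measure (ℝ × ℝ)) (y v : ℝ) : ℝ :=
  ∫ θ, gaussianPDFReal θ.1 (θ.2 ^ 2 / J).toNNReal y *
    gammaPDFReal (shape J) (shape J / θ.2 ^ 2) v ∂G

/-- Integrand of the Tweedie formula for the posterior mean of `σ²`, as a functional of a
density `f`. -/
noncomputable def tweedieVarIntegrand (J : ℕ) (f : ℝ → ℝ → ℝ) (y v t : ℝ) : ℝ :=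
  (v / t) ^ (shape J - 1) * (f y t / f y v)

/-- Integrand of the Tweedie formula for the posterior mean of `σ`. -/
noncomputable def tweedieSdIntegrand (J : ℕ) (f : ℝ → ℝ → ℝ) (y v t : ℝ) : ℝ :=
  1 / Real.sqrt (shape J * (t - v)) * (v / t) ^ (shape J - 1) * (f y t / f y v)

/-- Tweedie formula for the posterior mean of `σ²`. -/
noncomputable def tweedieVar (J : ℕ) (f : ℝ → ℝ → ℝ) (y v : ℝ) : ℝ :=
  shape J * ∫ t in Ioi v, tweedieVarIntegrand J f y v t

/-- Tweedie formula for the posterior mean of `σ`. -/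
noncomputable def tweedieSd (J : ℕ) (f : ℝ → ℝ → ℝ) (y v : ℝ) : ℝ :=
  shape J / Real.Gamma (1 / 2) * ∫ t in Ioi v, tweedieSdIntegrand J f y v t

/-- Tweedie formula for the posterior mean of `μ`. -/
noncomputable def tweedieMean (J : ℕ) (f : ℝ → ℝ → ℝ) (y v : ℝ) : ℝ :=
  y + tweedieVar J f y v / J * deriv (fun x => Real.log (f x v)) y
    + 1 / (J : ℝ) * deriv (fun x => tweedieVar J f x v) y

/-- Tweedie formula for the optimal quantile estimator: a functional of the density `f` alone. -/
noncomputable def tweedieQuantile (J : ℕ) (α : ℝ) (f : ℝ → ℝ → ℝ) (y v : ℝ) : ℝ :=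
  tweedieMean J f y v + tweedieSd J f y v * stdNormalQuantile α

/-- All expressions in the Tweedie formulae are well defined at every `y` and every `v > 0`. -/
def TweedieWellDefined (J : ℕ) (f : ℝ → ℝ → ℝ) : Prop :=
  ∀ y v : ℝ, 0 < v →
    0 < f y v ∧
    DifferentiableAt ℝ (fun x => f x v) y ∧
    DifferentiableAt ℝ (fun x => tweedieVar J f x v) y ∧
    IntegrableOn (tweedieVarIntegrand J f y v) (Ioi v) ∧
    IntegrableOn (tweedieSdIntegrand J f y v) (Ioi v)

end HeteroEB

/-! The quantile `μ + σ Φ⁻¹(α)` is affine in `(μ, σ)`, so under squared loss its best predictor is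
its posterior mean. For each unit, the posterior given all the data depends only on that unit's `(y,
s)`: other units are independent, and mean and variance are sufficient (`dataDensity_eq`,
`lintegral_posterior_dataLaw`). A bias-variance identity valid in `[0, ∞]` then writes any risk as
the oracle risk plus the mean squared distance to the oracle (`risk_eq_risk_oracle_add`); optimality
and uniqueness follow.

For the formulas, put `τ = σ⁻²`. The sampling density is `p(y, v) = C(v) τ^(J/2) exp(-τ (J (y -
μ)²/2 + k v))` with `C(v)` proportional to `v^(k-1)` (`samplingDensity_eq`). Hence `(v/t)^(k-1) p(y,
t) = p(y, v) exp(-kτ(t - v))`. Integrating over `t > v`, with weight `1` or `(k(t - v))^(-1/2)`,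
produces `σ²/k` or `Γ(1/2) σ/k` times `p(y, v)`. After mixing over `G`, `V` and `S` are the
posterior means of `σ²` and `σ`. Since `∂_y p = -Jτ(y - μ) p`, the product `V f = ∫ σ² p dG` has
`y`-derivative `-J ∫ (y - μ) p dG`; expanding it by the product rule and dividing by `J f` gives the
posterior mean of `μ`.

No moments of `G` are needed: for fixed `v > 0`, the exponential factors keep `p` bounded in `θ`
even after multiplication by `σ`, `σ²` or `|y - μ|`. Finally, Bayes' formula identifies the abstract
conditional distribution almost surely, and positivity of `f` turns this into a statement Lebesgue
almost everywhere. -/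

namespace HeteroEB

open scoped ENNReal

/-! ### Finite products of measures with densities -/

section Product

theorem lintegral_fin_prod_eq_prod {n : ℕ} {X : Type*} [MeasurableSpace X] (μ : Measure X)
    [SigmaFinite μ] (f : Fin n → X → ℝ≥0∞) (hf : ∀ i, Measurable (f i)) :
    ∫⁻ x, ∏ i, f i (x i) ∂(Measure.pi fun _ : Fin n => μ) = ∏ i, ∫⁻ x, f i x ∂μ := by
  induction n with
  | zero => simp
  | succ n ih =>
    have h := (measurePreserving_piFinSuccAbove (fun _ : Fin (n + 1) => μ) 0).symm
    rw [← h.lintegral_comp_emb (MeasurableEquiv.measurableEmbedding _)]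
    simp_rw [Fin.prod_univ_succ]
    rw [← ih _ fun i => hf i.succ, ← lintegral_prod_mul (hf 0).aemeasurable]
    · simp [MeasurableEquiv.piFinSuccAbove, Fin.insertNthEquiv]
    · exact (Finset.measurable_prod _ fun i _ => (hf i.succ).comp (measurable_pi_apply i)).aemeasurable

/-- Boxes determine a product measure, and on a box both the indicator and the density factor over
the coordinates. -/
theorem pi_withDensity {n : ℕ} {X : Type*} [MeasurableSpace X] (μ : Measure X)
    [SigmaFinite μ] (f : X → ℝ≥0∞) (hf : Measurable f) [SigmaFinite (μ.withDensity f)] :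
    Measure.pi (fun _ : Fin n => μ.withDensity f) =
      (Measure.pi fun _ : Fin n => μ).withDensity fun x => ∏ i, f (x i) := by
  refine Measure.pi_eq fun s hs => ?_
  rw [withDensity_apply _ (MeasurableSet.univ_pi hs),
    ← lintegral_indicator (MeasurableSet.univ_pi hs)]
  have : (Set.pi univ s).indicator (fun x : Fin n → X => ∏ i, f (x i)) =
      fun x => ∏ i, (s i).indicator f (x i) := by
    ext x
    by_cases hx : x ∈ Set.pi univ s
    · rw [indicator_of_mem hx]
      exact Finset.prod_congr rfl fun i _ => (indicator_of_mem (hx i (mem_univ i)) f).symm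
    · rw [indicator_of_notMem hx]
      simp only [Set.mem_pi, mem_univ, true_implies, not_forall] at hx
      obtain ⟨i, hi⟩ := hx
      exact (Finset.prod_eq_zero (Finset.mem_univ i) (indicator_of_notMem hi f)).symm
  rw [this, lintegral_fin_prod_eq_prod μ _ fun i => hf.indicator (hs i)]
  exact Finset.prod_congr rfl fun i _ => by
    rw [withDensity_apply _ (hs i), lintegral_indicator (hs i)]

end Product

/-! ### Sums of squares of normal variables -/

section ChiSquare

theorem prod_gaussianPDFReal {n : ℕ} (μ : ℝ) (v : NNReal) (x : Fin n → ℝ) :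
    ∏ i, gaussianPDFReal μ v (x i) =
      ((Real.sqrt (2 * Real.pi * v))⁻¹) ^ n * Real.exp (-(∑ i, (x i - μ) ^ 2) / (2 * v)) := by
  simp only [gaussianPDFReal]
  rw [Finset.prod_mul_distrib, Finset.prod_const, Finset.card_univ, Fintype.card_fin,
    ← Real.exp_sum]
  congr 2
  rw [← Finset.sum_div, Finset.sum_neg_distrib]

theorem unitNoise_eq_withDensity (n : ℕ) :
    unitNoise n = volume.withDensity fun x => ENNReal.ofReal
      (((Real.sqrt (2 * Real.pi))⁻¹) ^ n * Real.exp (-(∑ i, (x i) ^ 2) / 2)) := by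
  have : SigmaFinite ((volume : Measure ℝ).withDensity (gaussianPDF 0 1)) := by
    rw [← gaussianReal_of_var_ne_zero 0 one_ne_zero]; infer_instance
  unfold unitNoise
  simp_rw [gaussianReal_of_var_ne_zero 0 one_ne_zero]
  rw [pi_withDensity _ _ (measurable_gaussianPDF 0 1)]
  simp only [gaussianPDF]
  rw [← volume_pi]
  congr 1
  ext x
  rw [← ENNReal.ofReal_prod_of_nonneg fun i _ => gaussianPDFReal_nonneg 0 1 _,
    prod_gaussianPDFReal]
  simp

/-- The Gaussian density is radial, so polar coordinates apply. The constant need not be computed: a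
comparison of total masses fixes it later. -/
theorem exists_integral_unitNoise_comp_sum_sq (m : ℕ) :
    ∃ K : ℝ, ∀ F : ℝ → ℝ, ∫ z, F (∑ i, (z i) ^ 2) ∂(unitNoise (m + 1)) =
      K * ∫ r in Ioi (0 : ℝ), r ^ m * (F (r ^ 2) * Real.exp (-r ^ 2 / 2)) := by
  let C : ℝ := ((Real.sqrt (2 * Real.pi))⁻¹) ^ (m + 1)
  have hC : 0 ≤ C := by positivity
  refine ⟨C * ((m + 1) *
    (volume : Measure (EuclideanSpace ℝ (Fin (m + 1)))).real (Metric.ball 0 1)), fun F => ?_⟩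
  have h1 : ∫ z, F (∑ i, (z i) ^ 2) ∂(unitNoise (m + 1)) =
      ∫ z : Fin (m + 1) → ℝ, C * (F (∑ i, (z i) ^ 2) * Real.exp (-(∑ i, (z i) ^ 2) / 2)) := by
    rw [unitNoise_eq_withDensity, integral_withDensity_eq_integral_toReal_smul (by fun_prop)
      (ae_of_all _ fun _ => ENNReal.ofReal_lt_top)]
    refine integral_congr_ae (ae_of_all _ fun z => ?_)
    simp only [smul_eq_mul]
    rw [ENNReal.toReal_ofReal (by positivity)]
    simp only [C]
    ring
  have h2 := integral_fun_norm_addHaar (volume : Measure (EuclideanSpace ℝ (Fin (m + 1))))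
    (fun r => F (r ^ 2) * Real.exp (-r ^ 2 / 2))
  rw [h1, integral_const_mul, mul_assoc]
  congr 1
  rw [← (PiLp.volume_preserving_ofLp (Fin (m + 1))).integral_comp
    (MeasurableEquiv.toLp 2 _).symm.measurableEmbedding]
  simp only [EuclideanSpace.real_norm_sq_eq, finrank_euclideanSpace, Fintype.card_fin,
    Nat.add_sub_cancel, nsmul_eq_mul, smul_eq_mul] at h2
  rw [h2]
  push_cast
  ring

/-- The substitution `x = c r²` turns the gamma integral into the radial form of the Gaussian one,
with exponent `2a - 1` to be matched with `m`. -/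
theorem integral_gammaMeasure_sq {a c : ℝ} (ha : 0 < a) (hc : 0 < c) :
    ∃ K : ℝ, ∀ F : ℝ → ℝ, ∫ x, F x ∂(gammaMeasure a (1 / (2 * c))) =
      K * ∫ r in Ioi (0 : ℝ), r ^ (2 * a - 1) * (F (c * r ^ 2) * Real.exp (-r ^ 2 / 2)) := by
  let K : ℝ := (1 / (2 * c)) ^ a / Real.Gamma a
  refine ⟨K * (c * (c ^ (a - 1) * 2)), fun F => ?_⟩
  have h1 : ∫ x, F x ∂(gammaMeasure a (1 / (2 * c))) =
      ∫ x in Ioi (0 : ℝ), K * (x ^ (a - 1) * Real.exp (-(1 / (2 * c) * x)) * F x) := by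
    rw [gammaMeasure, integral_withDensity_eq_integral_toReal_smul
      (show Measurable (gammaPDF a _) from (measurable_gammaPDFReal _ _).ennreal_ofReal)
      (ae_of_all _ fun _ => ENNReal.ofReal_lt_top),
      ← integral_indicator measurableSet_Ioi]
    refine integral_congr_ae ?_
    filter_upwards [(measure_eq_zero_iff_ae_notMem.1 (Real.volume_singleton (a := 0)))] with x hx
    simp only [smul_eq_mul, gammaPDF]
    rw [ENNReal.toReal_ofReal (gammaPDFReal_nonneg ha (by positivity) _), gammaPDFReal]
    rcases lt_trichotomy x 0 with h | h | h
    · rw [if_neg (by linarith), indicator_of_notMem (by simpa using h.le), zero_mul]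
    · exact absurd h hx
    · rw [if_pos h.le, indicator_of_mem (by simpa using h)]
      simp only [K]
      ring
  have h2 := integral_comp_mul_left_Ioi
    (fun x : ℝ => x ^ (a - 1) * Real.exp (-(1 / (2 * c) * x)) * F x) 0 hc
  have h3 := integral_comp_rpow_Ioi_of_pos
    (g := fun x : ℝ => (c * x) ^ (a - 1) * Real.exp (-(1 / (2 * c) * (c * x))) * F (c * x))
    (p := 2) two_pos
  rw [mul_zero] at h2
  rw [h1, integral_const_mul, mul_assoc]
  congr 1
  have h4 : ∫ x in Ioi (0 : ℝ), x ^ (a - 1) * Real.exp (-(1 / (2 * c) * x)) * F x =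
      c * ∫ x in Ioi (0 : ℝ), (c * x) ^ (a - 1) * Real.exp (-(1 / (2 * c) * (c * x))) * F (c * x) := by
    rw [h2, smul_eq_mul, ← mul_assoc, mul_inv_cancel₀ hc.ne', one_mul]
  rw [h4, mul_assoc]
  congr 1
  rw [← h3, ← integral_const_mul]
  refine setIntegral_congr_fun measurableSet_Ioi fun r hr => ?_
  have hr : 0 < r := hr
  simp only [smul_eq_mul, Real.rpow_ofNat]
  have e1 : 1 / (2 * c) * (c * r ^ 2) = r ^ 2 / 2 := by field_simp
  rw [Real.mul_rpow hc.le (by positivity), e1, ← Real.rpow_natCast r 2, ← Real.rpow_mul hr.le,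
    show (2 * a - 1) = (2 - 1) + ((2 : ℕ) : ℝ) * (a - 1) by push_cast; ring, Real.rpow_add hr]
  simp only [Nat.cast_ofNat, neg_div]
  ring

/-- A multiple of a sum of squares of independent standard normal variables is gamma distributed. -/
theorem map_const_mul_sum_sq_unitNoise (m : ℕ) {c : ℝ} (hc : 0 < c) :
    (unitNoise (m + 1)).map (fun z => c * ∑ i, (z i) ^ 2) =
      gammaMeasure (((m : ℝ) + 1) / 2) (1 / (2 * c)) := by
  have hm : Measurable fun z : Fin (m + 1) → ℝ => c * ∑ i, (z i) ^ 2 := by fun_prop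
  have ha : 0 < ((m : ℝ) + 1) / 2 := by positivity
  have := isProbabilityMeasure_gammaMeasure ha (r := 1 / (2 * c)) (by positivity)
  have := Measure.isProbabilityMeasure_map (μ := unitNoise (m + 1)) hm.aemeasurable
  obtain ⟨K, hK⟩ := exists_integral_unitNoise_comp_sum_sq m
  obtain ⟨L, hL⟩ := integral_gammaMeasure_sq ha hc
  have hK' : ∀ F : ℝ → ℝ, Measurable F → ∫ x, F x ∂((unitNoise (m + 1)).map
      (fun z => c * ∑ i, (z i) ^ 2)) =
      K * ∫ r in Ioi (0 : ℝ), r ^ m * (F (c * r ^ 2) * Real.exp (-r ^ 2 / 2)) := by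
    intro F hF
    rw [integral_map hm.aemeasurable hF.aestronglyMeasurable, ← hK fun x => F (c * x)]
  have hL' : ∀ F : ℝ → ℝ, ∫ x, F x ∂(gammaMeasure (((m : ℝ) + 1) / 2) (1 / (2 * c))) =
      L * ∫ r in Ioi (0 : ℝ), r ^ m * (F (c * r ^ 2) * Real.exp (-r ^ 2 / 2)) := by
    intro F
    rw [hL, show 2 * (((m : ℝ) + 1) / 2) - 1 = m by ring]
    simp_rw [Real.rpow_natCast]
  -- Testing both formulas with the constant `1`: each law has mass one, so the common radial
  -- integral is nonzero and the two constants agree.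
  have h1 := hK' (fun _ => 1) measurable_const
  have h2 := hL' (fun _ => 1)
  simp only [integral_const, probReal_univ, smul_eq_mul, mul_one] at h1 h2
  have hKL : K = L := mul_right_cancel₀ (right_ne_zero_of_mul (h1 ▸ one_ne_zero)) (h1.symm.trans h2)
  ext s hs
  rw [← measureReal_eq_measureReal_iff]
  rw [← integral_indicator_one hs, ← integral_indicator_one hs, hL', hK', hKL]
  exact measurable_one.indicator hs

end ChiSquare

/-! ### Sampling laws of the mean and the variance, and sufficiency -/

section Statistics

theorem measurable_sampleMean (J : ℕ) : Measurable (sampleMean : (Fin J → ℝ) → ℝ) := by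
  unfold sampleMean; fun_prop

theorem measurable_sampleVar (J : ℕ) : Measurable (sampleVar : (Fin J → ℝ) → ℝ) := by
  have := measurable_sampleMean J
  unfold sampleVar; fun_prop

theorem measurable_sampleSd (J : ℕ) : Measurable (sampleSd : (Fin J → ℝ) → ℝ) :=
  (measurable_sampleVar J).sqrt

theorem measurable_unitData (J : ℕ) :
    Measurable fun ω : (ℝ × ℝ) × (Fin J → ℝ) => unitData ω.1 ω.2 := by
  unfold unitData; fun_prop

theorem sum_sub_sq_eq {J : ℕ} (hJ : 0 < J) (x : Fin J → ℝ) (a : ℝ) :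
    ∑ j, (x j - a) ^ 2 = ∑ j, (x j - sampleMean x) ^ 2 + J * (sampleMean x - a) ^ 2 := by
  have hJ' : (J : ℝ) ≠ 0 := by positivity
  have hs : ∑ j, x j = J * sampleMean x := by unfold sampleMean; field_simp
  simp only [sub_sq, Finset.sum_add_distrib, Finset.sum_sub_distrib, ← Finset.mul_sum,
    ← Finset.sum_mul, hs, Finset.sum_const, Finset.card_univ, Fintype.card_fin, nsmul_eq_mul]
  ring

theorem sampleMean_unitData {J : ℕ} (hJ : 0 < J) (θ : ℝ × ℝ) (ε : Fin J → ℝ) :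
    sampleMean (unitData θ ε) = θ.1 + θ.2 * sampleMean ε := by
  have hJ' : (J : ℝ) ≠ 0 := by positivity
  simp only [sampleMean, unitData, Finset.sum_add_distrib, ← Finset.mul_sum, Finset.sum_const,
    Finset.card_univ, Fintype.card_fin, nsmul_eq_mul]
  field_simp

theorem sampleVar_unitData {J : ℕ} (hJ : 0 < J) (θ : ℝ × ℝ) (ε : Fin J → ℝ) :
    sampleVar (unitData θ ε) = θ.2 ^ 2 * sampleVar ε := by
  simp only [sampleVar, sampleMean_unitData hJ]
  have h : ∑ j, (unitData θ ε j - (θ.1 + θ.2 * sampleMean ε)) ^ 2 =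
      θ.2 ^ 2 * ∑ j, (ε j - sampleMean ε) ^ 2 := by
    rw [Finset.mul_sum]
    refine Finset.sum_congr rfl fun j _ => ?_
    simp only [unitData]
    ring
  rw [h, mul_left_comm]

/-- Extend the unit vector `(1, …, 1)/√J` to an orthonormal basis; the standard Gaussian is
invariant under this rotation. In the new coordinates the sample mean sees only `z 0`, which
separates it from the squared deviations. -/
theorem exists_rotation_unitNoise (m : ℕ) :
    ∃ b : (Fin (m + 1) → ℝ) → (Fin (m + 1) → ℝ), Measurable b ∧
      (unitNoise (m + 1)).map b = unitNoise (m + 1) ∧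
      ∀ z, sampleMean (b z) = z 0 / Real.sqrt ((m + 1 : ℕ) : ℝ) ∧
        ∑ j, (b z j) ^ 2 = ∑ j, (z j) ^ 2 := by
  let J : ℝ := ((m + 1 : ℕ) : ℝ)
  have hJ : 0 < J := by simp only [J]; positivity
  have hsq : Real.sqrt J * Real.sqrt J = J := Real.mul_self_sqrt hJ.le
  have hsJ : 0 < Real.sqrt J := Real.sqrt_pos.2 hJ
  let u : EuclideanSpace ℝ (Fin (m + 1)) := WithLp.toLp 2 fun _ => (Real.sqrt J)⁻¹
  have hu : ‖u‖ = 1 := by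
    rw [← sq_eq_sq₀ (norm_nonneg _) zero_le_one, EuclideanSpace.real_norm_sq_eq]
    simp only [u, inv_pow, Real.sq_sqrt hJ.le, Finset.sum_const, Finset.card_univ, Fintype.card_fin,
      nsmul_eq_mul, one_pow]
    exact mul_inv_cancel₀ hJ.ne'
  obtain ⟨b, hb⟩ := Orthonormal.exists_orthonormalBasis_extension_of_card_eq (𝕜 := ℝ)
    (E := EuclideanSpace ℝ (Fin (m + 1))) (ι := Fin (m + 1)) (by simp) (v := fun _ => u)
    (s := {0}) (by
      rw [orthonormal_iff_ite]
      rintro ⟨i, rfl⟩ ⟨j, rfl⟩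
      simp [hu])
  have hb0 : b 0 = u := hb 0 rfl
  have hcont : Continuous fun z : Fin (m + 1) → ℝ => ∑ i, z i • b i := by fun_prop
  refine ⟨fun z => WithLp.ofLp (∑ i, z i • b i), ?_, ?_, fun z => ⟨?_, ?_⟩⟩
  · exact (MeasurableEquiv.toLp 2 _).symm.measurable.comp hcont.measurable
  · have h := stdGaussian_eq_map_pi_orthonormalBasis b
    rw [← map_pi_eq_stdGaussian] at h
    have h2 := congrArg (Measure.map (WithLp.ofLp : EuclideanSpace ℝ (Fin (m + 1)) → _)) h
    rw [Measure.map_map (by fun_prop) (by fun_prop), Measure.map_map (by fun_prop) hcont.measurable]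
      at h2
    refine h2.symm.trans ?_
    exact Measure.map_id
  · have h1 : inner ℝ u (∑ i, z i • b i) = z 0 := by
      rw [← hb0]
      simp [inner_sum, inner_smul_right, orthonormal_iff_ite.1 b.orthonormal]
    rw [PiLp.inner_apply] at h1
    simp only [u, RCLike.inner_apply, conj_trivial] at h1
    rw [← Finset.sum_mul] at h1
    simp only [sampleMean]
    change 1 / J * _ = z 0 / Real.sqrt J
    rw [← h1, div_eq_mul_inv _ (Real.sqrt J), mul_assoc, ← mul_inv, hsq, one_div, mul_comm]
  · have h1 : ‖∑ i, z i • b i‖ ^ 2 = ∑ j, (z j) ^ 2 := by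
      rw [← real_inner_self_eq_norm_sq, b.orthonormal.inner_sum]
      simp [sq]
    rw [← h1, EuclideanSpace.real_norm_sq_eq]

/-- Sample mean and sample variance of standard normal noise are independent, the first one being
normal and the second one gamma distributed. -/
theorem map_sampleMean_sampleVar_unitNoise {J : ℕ} (hJ : 1 < J) :
    (unitNoise J).map (fun ε => (sampleMean ε, sampleVar ε)) =
      (gaussianReal 0 (1 / J)).prod (gammaMeasure (shape J) (shape J)) := by
  -- One coordinate carries the mean; the other `J - 1 = m + 1 ≥ 1` carry the variance.
  obtain ⟨m, rfl⟩ : ∃ m, J = m + 1 + 1 := ⟨J - 2, by omega⟩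
  obtain ⟨b, hbm, hb, hbs⟩ := exists_rotation_unitNoise (m + 1)
  have hM : (0 : ℝ) < (m : ℝ) + 1 := by positivity
  have hJ0 : (0 : ℝ) < ((m + 1 + 1 : ℕ) : ℝ) := by positivity
  have hT : Measurable fun ε : Fin (m + 1 + 1) → ℝ => (sampleMean ε, sampleVar ε) :=
    (measurable_sampleMean _).prodMk (measurable_sampleVar _)
  have hvar : ∀ z, sampleVar (b z) = 1 / ((m : ℝ) + 1) * ∑ i : Fin (m + 1), (z i.succ) ^ 2 := by
    intro z
    -- In `∑ x_j² = ∑ (x_j - mean)² + J mean²` the last term equals `z 0 ^ 2`, so the deviations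
    -- retain exactly the remaining squares.
    have h := sum_sub_sq_eq (Nat.succ_pos _) (b z) 0
    simp only [sub_zero] at h
    rw [(hbs z).2, (hbs z).1, div_pow, Real.sq_sqrt hJ0.le, mul_div_cancel₀ _ hJ0.ne',
      Fin.sum_univ_succ, ← (hbs z).1] at h
    have h' : ∑ j, (b z j - sampleMean (b z)) ^ 2 = ∑ i : Fin (m + 1), z i.succ ^ 2 := by linarith
    simp only [sampleVar]
    rw [h']
    push_cast
    congr 2
    ring
  have hcomp : (fun ε : Fin (m + 1 + 1) → ℝ => (sampleMean ε, sampleVar ε)) ∘ b =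
      Prod.map (fun x : ℝ => x / Real.sqrt ((m + 1 + 1 : ℕ) : ℝ))
        (fun z : Fin (m + 1) → ℝ => 1 / ((m : ℝ) + 1) * ∑ i, (z i) ^ 2) ∘
        MeasurableEquiv.piFinSuccAbove (fun _ => ℝ) 0 := by
    ext z
    · simp [(hbs z).1, MeasurableEquiv.piFinSuccAbove, Fin.insertNthEquiv]
    · simp [hvar z, MeasurableEquiv.piFinSuccAbove, Fin.insertNthEquiv, Fin.tail]
  have hpres := measurePreserving_piFinSuccAbove (fun _ : Fin (m + 1 + 1) => gaussianReal 0 1) 0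
  rw [← hb, Measure.map_map hT hbm, hcomp, ← Measure.map_map (by fun_prop) (by fun_prop)]
  conv_lhs => rw [unitNoise, hpres.map_eq]
  rw [← Measure.map_prod_map _ _ (by fun_prop) (by fun_prop)]
  congr 1
  · rw [gaussianReal_map_div_const]
    congr 1
    · simp
    · ext
      push_cast
      rw [Real.sq_sqrt (by positivity)]
  -- With `c = 1/(J - 1)` the rate `1/(2c)` is `(J - 1)/2`, the same number as the shape.
  · have := map_const_mul_sum_sq_unitNoise m (c := 1 / ((m : ℝ) + 1)) (by positivity)
    rw [unitNoise] at this
    rw [this]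
    congr 1
    · simp only [shape]; push_cast; ring
    · simp only [shape]; push_cast; field_simp; ring

theorem measurable_gammaPDF (a r : ℝ) : Measurable (gammaPDF a r) :=
  (measurable_gammaPDFReal a r).ennreal_ofReal

theorem gammaMeasure_map_const_mul {a r c : ℝ} (hr : 0 < r) (hc : 0 < c) :
    (gammaMeasure a r).map (fun x => c * x) = gammaMeasure a (r / c) := by
  ext s hs
  have hms := (measurable_gammaPDF a (r / c)).indicator hs
  rw [Measure.map_apply (by fun_prop) hs, gammaMeasure, gammaMeasure, withDensity_apply _ hs,
    withDensity_apply _ (hs.preimage (by fun_prop)), ← lintegral_indicator hs,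
    ← lintegral_indicator (hs.preimage (by fun_prop))]
  have h2 := Real.smul_map_volume_mul_left hc.ne'
  conv_rhs => rw [← h2]
  rw [lintegral_smul_measure, lintegral_map hms (by fun_prop),
    smul_eq_mul, ← lintegral_const_mul _ (hms.fun_comp (measurable_const_mul c))]
  refine lintegral_congr fun x => ?_
  by_cases hx : c * x ∈ s
  · rw [indicator_of_mem (by exact hx), indicator_of_mem hx, gammaPDF, gammaPDF,
      ← ENNReal.ofReal_mul (abs_nonneg _), abs_of_pos hc]
    congr 1
    simp only [gammaPDFReal, mul_nonneg_iff_of_pos_left hc]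
    split_ifs with h
    · have hca : c ^ a ≠ 0 := (Real.rpow_pos_of_pos hc a).ne'
      have e : r / c * (c * x) = r * x := by field_simp
      rw [Real.mul_rpow hc.le h, Real.div_rpow hr.le hc.le, Real.rpow_sub_one hc.ne', e]
      field_simp
    · simp
  · rw [indicator_of_notMem (by exact hx), indicator_of_notMem hx, mul_zero]

/-- Sampling density of (sample mean, sample variance) of one unit with parameter `θ = (μ, σ)`. -/
noncomputable def samplingDensity (J : ℕ) (θ : ℝ × ℝ) (y v : ℝ) : ℝ :=
  gaussianPDFReal θ.1 (θ.2 ^ 2 / J).toNNReal y * gammaPDFReal (shape J) (shape J / θ.2 ^ 2) v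

theorem mixtureDensity_eq_integral (J : ℕ) (G : Measure (ℝ × ℝ)) (y v : ℝ) :
    mixtureDensity J G y v = ∫ θ, samplingDensity J θ y v ∂G := rfl

theorem measurable_samplingDensity (J : ℕ) :
    Measurable fun p : (ℝ × ℝ) × (ℝ × ℝ) => samplingDensity J p.1 p.2.1 p.2.2 := by
  unfold samplingDensity
  refine Measurable.mul ?_ ?_
  · exact measurable_uncurry_gaussianPDFReal.fun_comp
      (f := fun p : (ℝ × ℝ) × (ℝ × ℝ) => (p.1.1, (p.1.2 ^ 2 / (J : ℝ)).toNNReal, p.2.1))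
      (by fun_prop)
  · unfold gammaPDFReal
    refine Measurable.ite (measurableSet_le measurable_const (by fun_prop)) ?_ measurable_const
    fun_prop

theorem shape_pos {J : ℕ} (hJ : 1 < J) : 0 < shape J := by
  have : (1 : ℝ) < J := by exact_mod_cast hJ
  unfold shape; linarith

theorem samplingDensity_nonneg {J : ℕ} (hJ : 1 < J) {θ : ℝ × ℝ} (hθ : 0 < θ.2) (y v : ℝ) :
    0 ≤ samplingDensity J θ y v :=
  have := shape_pos hJ
  mul_nonneg (gaussianPDFReal_nonneg _ _ _) (gammaPDFReal_nonneg this (by positivity) _)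

/-- Sampling law of (sample mean, sample variance). -/
theorem map_sampleMean_sampleVar_unitData {J : ℕ} (hJ : 1 < J) {θ : ℝ × ℝ} (hθ : 0 < θ.2) :
    (unitNoise J).map (fun ε => (sampleMean (unitData θ ε), sampleVar (unitData θ ε))) =
      volume.withDensity fun p : ℝ × ℝ => ENNReal.ofReal (samplingDensity J θ p.1 p.2) := by
  have hk := shape_pos hJ
  have hJ0 : (0 : ℝ) < J := by exact_mod_cast (zero_lt_one.trans hJ)
  have hcomp : (fun ε : Fin J → ℝ => (sampleMean (unitData θ ε), sampleVar (unitData θ ε))) =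
      Prod.map (fun x => θ.1 + θ.2 * x) (fun x => θ.2 ^ 2 * x) ∘
        fun ε => (sampleMean ε, sampleVar ε) := by
    ext ε <;> simp [sampleMean_unitData (zero_lt_one.trans hJ),
      sampleVar_unitData (zero_lt_one.trans hJ)]
  have hT : Measurable fun ε : Fin J → ℝ => (sampleMean ε, sampleVar ε) :=
    (measurable_sampleMean _).prodMk (measurable_sampleVar _)
  have := isProbabilityMeasure_gammaMeasure hk hk
  rw [hcomp, ← Measure.map_map (by fun_prop) hT, map_sampleMean_sampleVar_unitNoise hJ,
    ← Measure.map_prod_map _ _ (by fun_prop) (by fun_prop),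
    gammaMeasure_map_const_mul hk (by positivity)]
  have h1 : (gaussianReal 0 (1 / (J : NNReal))).map (fun x => θ.1 + θ.2 * x) =
      gaussianReal θ.1 (θ.2 ^ 2 / J).toNNReal := by
    rw [show (fun x => θ.1 + θ.2 * x) = (fun x => θ.1 + x) ∘ (fun x => θ.2 * x) from rfl,
      ← Measure.map_map (by fun_prop) (by fun_prop), gaussianReal_map_const_mul,
      gaussianReal_map_const_add]
    congr 1
    · simp
    · ext
      rw [Real.coe_toNNReal _ (by positivity)]
      push_cast
      simp [div_eq_mul_inv]
  rw [h1, gaussianReal_of_var_ne_zero _ (by positivity), gammaMeasure,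
    prod_withDensity (measurable_gaussianPDF _ _) (measurable_gammaPDF _ _), ← Measure.volume_eq_prod]
  congr 1
  ext p
  rw [gaussianPDF, gammaPDF, ← ENNReal.ofReal_mul (gaussianPDFReal_nonneg _ _ _)]
  rfl

theorem gaussianReal_map_affine (μ σ : ℝ) :
    (gaussianReal 0 1).map (fun x => μ + σ * x) = gaussianReal μ (σ ^ 2).toNNReal := by
  rw [show (fun x => μ + σ * x) = (fun x => μ + x) ∘ (fun x => σ * x) from rfl,
    ← Measure.map_map (by fun_prop) (by fun_prop), gaussianReal_map_const_mul,
    gaussianReal_map_const_add]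
  congr 1
  · simp
  · ext
    rw [Real.coe_toNNReal _ (by positivity)]
    simp

/-- Sampling density of the observations of one unit with parameter `θ = (μ, σ)`. -/
noncomputable def dataDensity {J : ℕ} (θ : ℝ × ℝ) (x : Fin J → ℝ) : ℝ :=
  ∏ j, gaussianPDFReal θ.1 (θ.2 ^ 2).toNNReal (x j)

theorem map_unitData {J : ℕ} {θ : ℝ × ℝ} (hθ : 0 < θ.2) :
    (unitNoise J).map (unitData θ) = volume.withDensity fun x : Fin J → ℝ =>
      ENNReal.ofReal (dataDensity θ x) := by
  have hv : (θ.2 ^ 2).toNNReal ≠ 0 := by positivity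
  have : SigmaFinite ((volume : Measure ℝ).withDensity (gaussianPDF θ.1 (θ.2 ^ 2).toNNReal)) := by
    rw [← gaussianReal_of_var_ne_zero _ hv]; infer_instance
  have h2 := (measurePreserving_pi (fun _ : Fin J => gaussianReal 0 1) (fun _ : Fin J =>
    gaussianReal θ.1 (θ.2 ^ 2).toNNReal) fun _ => ⟨(by fun_prop : Measurable
      fun x : ℝ => θ.1 + θ.2 * x), gaussianReal_map_affine θ.1 θ.2⟩).map_eq
  refine h2.trans ?_
  simp_rw [gaussianReal_of_var_ne_zero _ hv]
  rw [pi_withDensity _ _ (measurable_gaussianPDF _ _), ← volume_pi]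
  congr 1
  ext x
  simp only [gaussianPDF, dataDensity]
  rw [← ENNReal.ofReal_prod_of_nonneg fun i _ => gaussianPDFReal_nonneg _ _ _]

theorem measurable_dataDensity (J : ℕ) :
    Measurable fun p : (ℝ × ℝ) × (Fin J → ℝ) => dataDensity p.1 p.2 := by
  unfold dataDensity
  refine Finset.measurable_prod _ fun j _ => ?_
  exact measurable_uncurry_gaussianPDFReal.fun_comp
      (f := fun p : (ℝ × ℝ) × (Fin J → ℝ) => (p.1.1, (p.1.2 ^ 2).toNNReal, p.2 j))
      (by fun_prop)

/-- Explicit form of the sampling density, with constant factor `C J v`. -/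
noncomputable def samplingConst (J : ℕ) (v : ℝ) : ℝ :=
  Real.sqrt (J / (2 * Real.pi)) * (shape J ^ shape J / Real.Gamma (shape J) * v ^ (shape J - 1))

theorem samplingConst_pos {J : ℕ} (hJ : 1 < J) {v : ℝ} (hv : 0 < v) : 0 < samplingConst J v := by
  have hk := shape_pos hJ
  have hJ0 : (0 : ℝ) < J := by exact_mod_cast (zero_lt_one.trans hJ)
  have := Real.Gamma_pos_of_pos hk
  unfold samplingConst
  positivity

/-- In the precision `τ = σ⁻²` the normal factor contributes `τ^(1/2)` and the gamma factor `τ^k`,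
together `τ^(J/2)`. The bounds, derivatives and Tweedie identities are all read off from this form.
-/
theorem samplingDensity_eq {J : ℕ} (hJ : 1 < J) {θ : ℝ × ℝ} (hθ : 0 < θ.2) (y : ℝ) {v : ℝ}
    (hv : 0 < v) :
    samplingDensity J θ y v = samplingConst J v * (((θ.2 ^ 2)⁻¹) ^ ((J : ℝ) / 2) *
      Real.exp (-((θ.2 ^ 2)⁻¹ * (J * (y - θ.1) ^ 2 / 2 + shape J * v)))) := by
  have hk := shape_pos hJ
  have hJ0 : (0 : ℝ) < J := by exact_mod_cast (zero_lt_one.trans hJ)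
  have hτ : 0 < (θ.2 ^ 2)⁻¹ := by positivity
  have e1 : (Real.sqrt (2 * Real.pi * (θ.2 ^ 2 / J)))⁻¹ =
      Real.sqrt (J / (2 * Real.pi)) * ((θ.2 ^ 2)⁻¹) ^ (1 / 2 : ℝ) := by
    rw [← Real.sqrt_eq_rpow, ← Real.sqrt_inv, ← Real.sqrt_mul (by positivity)]
    congr 1
    field_simp
  have e2 : (J : ℝ) / 2 = 1 / 2 + shape J := by unfold shape; ring
  have e3 : (shape J / θ.2 ^ 2) ^ shape J = shape J ^ shape J * ((θ.2 ^ 2)⁻¹) ^ shape J := by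
    rw [div_eq_mul_inv, Real.mul_rpow hk.le hτ.le]
  have e4 : -((θ.2 ^ 2)⁻¹ * (J * (y - θ.1) ^ 2 / 2 + shape J * v)) =
      -(y - θ.1) ^ 2 / (2 * (θ.2 ^ 2 / J)) + -(shape J / θ.2 ^ 2 * v) := by
    field_simp
    ring
  rw [samplingDensity, gaussianPDFReal, gammaPDFReal, if_pos hv.le,
    Real.coe_toNNReal _ (by positivity), e1, e3, e4, Real.exp_add, e2, Real.rpow_add hτ,
    samplingConst]
  ring

theorem samplingDensity_pos {J : ℕ} (hJ : 1 < J) {θ : ℝ × ℝ} (hθ : 0 < θ.2) (y : ℝ) {v : ℝ}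
    (hv : 0 < v) : 0 < samplingDensity J θ y v := by
  rw [samplingDensity_eq hJ hθ y hv]
  have := samplingConst_pos hJ hv
  positivity

theorem dataDensity_pos {J : ℕ} {θ : ℝ × ℝ} (hθ : 0 < θ.2) (x : Fin J → ℝ) :
    0 < dataDensity θ x :=
  Finset.prod_pos fun _ _ => gaussianPDFReal_pos _ _ _ (by positivity)

/-- Factorization: (sample mean, sample variance) is a sufficient statistic. -/
theorem dataDensity_eq {J : ℕ} (hJ : 1 < J) {θ : ℝ × ℝ} (hθ : 0 < θ.2) (x : Fin J → ℝ)
    (hv : 0 < sampleVar x) :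
    dataDensity θ x = ((Real.sqrt (2 * Real.pi))⁻¹) ^ J / samplingConst J (sampleVar x) *
      samplingDensity J θ (sampleMean x) (sampleVar x) := by
  have hC := samplingConst_pos hJ hv
  have hJ1 : (1 : ℝ) < J := by exact_mod_cast hJ
  have hτ : 0 < (θ.2 ^ 2)⁻¹ := by positivity
  rw [samplingDensity_eq hJ hθ _ hv, dataDensity, prod_gaussianPDFReal,
    sum_sub_sq_eq (zero_lt_one.trans hJ), Real.coe_toNNReal _ (by positivity)]
  have e1 : ∑ j, (x j - sampleMean x) ^ 2 = (J - 1) * sampleVar x := by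
    have : (J : ℝ) - 1 ≠ 0 := by linarith
    unfold sampleVar
    field_simp
  have e2 : (Real.sqrt (2 * Real.pi * θ.2 ^ 2))⁻¹ ^ J =
      ((Real.sqrt (2 * Real.pi))⁻¹) ^ J * ((θ.2 ^ 2)⁻¹) ^ ((J : ℝ) / 2) := by
    rw [Real.sqrt_mul (by positivity), mul_inv, mul_pow, ← Real.sqrt_inv (θ.2 ^ 2),
      Real.sqrt_eq_rpow (θ.2 ^ 2)⁻¹, ← Real.rpow_natCast (_ ^ (1 / 2 : ℝ)), ← Real.rpow_mul hτ.le]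
    congr 2
    ring
  rw [e1, e2]
  have e3 : -(((J : ℝ) - 1) * sampleVar x + J * (sampleMean x - θ.1) ^ 2) / (2 * θ.2 ^ 2) =
      -((θ.2 ^ 2)⁻¹ * (J * (sampleMean x - θ.1) ^ 2 / 2 + shape J * sampleVar x)) := by
    unfold shape
    field_simp
    ring
  rw [e3]
  field_simp

end Statistics

/-! ### Bounds uniform in the parameter, and integrability -/

section Bounds

/-- Raise `x ≤ exp x` at `x = c t / p` to the power `p`. -/
theorem rpow_mul_exp_neg_le {p c t : ℝ} (hp : 0 < p) (hc : 0 < c) (ht : 0 < t) :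
    t ^ p * Real.exp (-(t * c)) ≤ (p / c) ^ p := by
  have h1 : c / p * t ≤ Real.exp (c / p * t) := by linarith [Real.add_one_le_exp (c / p * t)]
  have h2 : (c / p * t) ^ p ≤ Real.exp (t * c) := by
    refine (Real.rpow_le_rpow (by positivity) h1 hp.le).trans_eq ?_
    rw [← Real.exp_mul]
    congr 1
    field_simp
  calc t ^ p * Real.exp (-(t * c))
      = (p / c) ^ p * (c / p * t) ^ p * Real.exp (-(t * c)) := by
        rw [← Real.mul_rpow (by positivity) (by positivity)]
        congr 2
        field_simp
    _ ≤ (p / c) ^ p * Real.exp (t * c) * Real.exp (-(t * c)) := by gcongr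
    _ = (p / c) ^ p := by rw [mul_assoc, ← Real.exp_add]; simp

/-- Dropping the quadratic term leaves `τ^(J/2 + r) exp(-τ k v)`, bounded because the exponent is
positive. Negative `r` are powers of `σ` (`-1/2` for `σ`, `-1` for `σ²`), so this bound replaces
moment assumptions on the prior. -/
theorem exists_bound_rpow_mul_samplingDensity {J : ℕ} (hJ : 1 < J) {r v : ℝ}
    (hr : 0 < (J : ℝ) / 2 + r) (hv : 0 < v) :
    ∃ M, ∀ θ : ℝ × ℝ, 0 < θ.2 → ∀ y, ((θ.2 ^ 2)⁻¹) ^ r * samplingDensity J θ y v ≤ M := by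
  have hk := shape_pos hJ
  have hC := samplingConst_pos hJ hv
  refine ⟨samplingConst J v * ((((J : ℝ) / 2 + r) / (shape J * v)) ^ ((J : ℝ) / 2 + r)),
    fun θ hθ y => ?_⟩
  have hτ : 0 < (θ.2 ^ 2)⁻¹ := by positivity
  rw [samplingDensity_eq hJ hθ y hv, mul_left_comm, ← mul_assoc (_ ^ r), ← Real.rpow_add hτ,
    add_comm r]
  refine mul_le_mul_of_nonneg_left (le_trans ?_ (rpow_mul_exp_neg_le hr (mul_pos hk hv) hτ)) hC.le
  gcongr
  exact le_add_of_nonneg_left (by positivity)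

/-- The factor `|y - μ|` is absorbed by the Gaussian exponential at the price of a factor `τ^(1/2)`,
whence the `-1/2` in the condition on `r`. -/
theorem exists_bound_rpow_mul_abs_mul_samplingDensity {J : ℕ} (hJ : 1 < J) {r v : ℝ}
    (hr : 0 < (J : ℝ) / 2 - 1 / 2 + r) (hv : 0 < v) :
    ∃ M, ∀ θ : ℝ × ℝ, 0 < θ.2 → ∀ y,
      ((θ.2 ^ 2)⁻¹) ^ r * |y - θ.1| * samplingDensity J θ y v ≤ M := by
  have hk := shape_pos hJ
  have hC := samplingConst_pos hJ hv
  have hJ1 : (1 : ℝ) ≤ J := by exact_mod_cast hJ.le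
  refine ⟨samplingConst J v *
    ((((J : ℝ) / 2 - 1 / 2 + r) / (shape J * v)) ^ ((J : ℝ) / 2 - 1 / 2 + r)),
    fun θ hθ y => ?_⟩
  have hτ : 0 < (θ.2 ^ 2)⁻¹ := by positivity
  set τ := (θ.2 ^ 2)⁻¹
  have h1 : |y - θ.1| * τ ^ (1 / 2 : ℝ) * Real.exp (-(τ * (J * (y - θ.1) ^ 2 / 2))) ≤ 1 := by
    set u := |y - θ.1| * τ ^ (1 / 2 : ℝ)
    have hu : u ^ 2 = τ * (y - θ.1) ^ 2 := by
      simp only [u]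
      rw [mul_pow, sq_abs, ← Real.sqrt_eq_rpow, Real.sq_sqrt hτ.le, mul_comm]
    -- `u ≤ (1 + u²)/2 ≤ 1 + J u²/2`, using `J ≥ 1`.
    have hu2 : u ≤ Real.exp (J * u ^ 2 / 2) := by
      have := Real.add_one_le_exp (J * u ^ 2 / 2)
      nlinarith [sq_nonneg (u - 1), sq_nonneg u]
    rw [show τ * (J * (y - θ.1) ^ 2 / 2) = J * u ^ 2 / 2 by rw [hu]; ring, Real.exp_neg,
      ← div_eq_mul_inv]
    exact (div_le_one (Real.exp_pos _)).2 hu2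
  have h2 := rpow_mul_exp_neg_le hr (mul_pos hk hv) hτ
  have e1 : τ ^ r * τ ^ ((J : ℝ) / 2) = τ ^ ((J : ℝ) / 2 - 1 / 2 + r) * τ ^ (1 / 2 : ℝ) := by
    rw [← Real.rpow_add hτ, ← Real.rpow_add hτ]
    congr 1
    ring
  calc τ ^ r * |y - θ.1| * samplingDensity J θ y v
      = samplingConst J v * ((|y - θ.1| * τ ^ (1 / 2 : ℝ) *
          Real.exp (-(τ * (J * (y - θ.1) ^ 2 / 2)))) *
          (τ ^ ((J : ℝ) / 2 - 1 / 2 + r) * Real.exp (-(τ * (shape J * v))))) := by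
        rw [samplingDensity_eq hJ hθ y hv, mul_add, neg_add, Real.exp_add]
        linear_combination samplingConst J v * |y - θ.1| *
          Real.exp (-(τ * (J * (y - θ.1) ^ 2 / 2))) * Real.exp (-(τ * (shape J * v))) * e1
    _ ≤ samplingConst J v * (1 * (τ ^ ((J : ℝ) / 2 - 1 / 2 + r) *
          Real.exp (-(τ * (shape J * v))))) := by gcongr
    _ ≤ _ := by rw [one_mul]; gcongr

theorem integrable_of_exists_bound {G : Measure (ℝ × ℝ)} [IsFiniteMeasure G]
    (hG : ∀ᵐ θ ∂G, 0 < θ.2) {g : ℝ × ℝ → ℝ} (hg : Measurable g)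
    (h : ∃ M, ∀ θ : ℝ × ℝ, 0 < θ.2 → |g θ| ≤ M) : Integrable g G := by
  obtain ⟨M, hM⟩ := h
  exact Integrable.of_bound hg.aestronglyMeasurable M (hG.mono fun θ hθ => hM θ hθ)

theorem measurable_samplingDensity_left (J : ℕ) (y v : ℝ) :
    Measurable fun θ => samplingDensity J θ y v :=
  (measurable_samplingDensity J).fun_comp (f := fun θ : ℝ × ℝ => (θ, (y, v))) (by fun_prop)

variable {J : ℕ} {G : Measure (ℝ × ℝ)} [IsFiniteMeasure G]

theorem integrable_rpow_mul_samplingDensity (hJ : 1 < J) (hG : ∀ᵐ θ ∂G, 0 < θ.2) {r v : ℝ}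
    (hr : 0 < (J : ℝ) / 2 + r) (hv : 0 < v) (y : ℝ) :
    Integrable (fun θ => ((θ.2 ^ 2)⁻¹) ^ r * samplingDensity J θ y v) G := by
  have := measurable_samplingDensity_left J y v
  obtain ⟨M, hM⟩ := exists_bound_rpow_mul_samplingDensity hJ hr hv
  refine integrable_of_exists_bound hG (by fun_prop) ⟨M, fun θ hθ => ?_⟩
  have := samplingDensity_nonneg hJ hθ y v
  rw [abs_of_nonneg (by positivity)]
  exact hM θ hθ y

theorem integrable_rpow_mul_sub_mul_samplingDensity (hJ : 1 < J) (hG : ∀ᵐ θ ∂G, 0 < θ.2)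
    {r v : ℝ} (hr : 0 < (J : ℝ) / 2 - 1 / 2 + r) (hv : 0 < v) (y : ℝ) :
    Integrable (fun θ => ((θ.2 ^ 2)⁻¹) ^ r * (y - θ.1) * samplingDensity J θ y v) G := by
  have := measurable_samplingDensity_left J y v
  obtain ⟨M, hM⟩ := exists_bound_rpow_mul_abs_mul_samplingDensity hJ hr hv
  refine integrable_of_exists_bound hG (by fun_prop) ⟨M, fun θ hθ => ?_⟩
  have h := samplingDensity_nonneg hJ hθ y v
  rw [abs_mul, abs_mul, abs_of_nonneg h, abs_of_nonneg (by positivity : 0 ≤ ((θ.2 ^ 2)⁻¹) ^ r)]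
  exact hM θ hθ y

theorem integrable_samplingDensity (hJ : 1 < J) (hG : ∀ᵐ θ ∂G, 0 < θ.2) {v : ℝ} (hv : 0 < v)
    (y : ℝ) : Integrable (fun θ => samplingDensity J θ y v) G := by
  simpa using integrable_rpow_mul_samplingDensity hJ hG (r := 0)
    (by have : (0 : ℝ) < J := by exact_mod_cast zero_lt_one.trans hJ
        linarith) hv y

/-- The density controls `y - μ`, so `μ` is written as `y - (y - μ)`. -/
theorem integrable_fst_mul_samplingDensity (hJ : 1 < J) (hG : ∀ᵐ θ ∂G, 0 < θ.2) {v : ℝ}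
    (hv : 0 < v) (y : ℝ) : Integrable (fun θ => θ.1 * samplingDensity J θ y v) G := by
  have hJ1 : (1 : ℝ) < J := by exact_mod_cast hJ
  have h := integrable_rpow_mul_sub_mul_samplingDensity hJ hG (r := 0) (by linarith) hv y
  simp only [Real.rpow_zero, one_mul] at h
  refine (((integrable_samplingDensity hJ hG hv y).const_mul y).sub h).congr (ae_of_all _ fun θ => ?_)
  simp only [Pi.sub_apply]
  ring

theorem inv_sq_rpow_neg_half {s : ℝ} (hs : 0 < s) : ((s ^ 2)⁻¹) ^ (-(1 / 2) : ℝ) = s := by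
  rw [Real.rpow_neg (by positivity), Real.inv_rpow (by positivity), inv_inv, ← Real.sqrt_eq_rpow,
    Real.sqrt_sq hs.le]

theorem inv_sq_rpow_neg_one (s : ℝ) : ((s ^ 2)⁻¹) ^ (-1 : ℝ) = s ^ 2 := by
  rw [Real.rpow_neg_one, inv_inv]

theorem integrable_snd_mul_samplingDensity (hJ : 1 < J) (hG : ∀ᵐ θ ∂G, 0 < θ.2) {v : ℝ}
    (hv : 0 < v) (y : ℝ) : Integrable (fun θ => θ.2 * samplingDensity J θ y v) G := by
  have hJ1 : (1 : ℝ) < J := by exact_mod_cast hJ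
  refine (integrable_rpow_mul_samplingDensity hJ hG (r := -(1 / 2)) (by linarith) hv y).congr ?_
  filter_upwards [hG] with θ hθ
  rw [inv_sq_rpow_neg_half hθ]

theorem integrable_snd_sq_mul_samplingDensity (hJ : 2 < J) (hG : ∀ᵐ θ ∂G, 0 < θ.2) {v : ℝ}
    (hv : 0 < v) (y : ℝ) : Integrable (fun θ => θ.2 ^ 2 * samplingDensity J θ y v) G := by
  have hJ1 : (2 : ℝ) < J := by exact_mod_cast hJ
  refine (integrable_rpow_mul_samplingDensity (by omega : 1 < J) hG (r := -1) (by linarith) hv y).congr ?_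
  filter_upwards [hG] with θ hθ
  rw [inv_sq_rpow_neg_one]

theorem mixtureDensity_pos (hJ : 1 < J) [NeZero G] (hG : ∀ᵐ θ ∂G, 0 < θ.2) (y : ℝ) {v : ℝ}
    (hv : 0 < v) : 0 < mixtureDensity J G y v := by
  rw [mixtureDensity_eq_integral, integral_pos_iff_support_of_nonneg_ae
    (hG.mono fun θ hθ => samplingDensity_nonneg hJ hθ y v) (integrable_samplingDensity hJ hG hv y)]
  have : Function.support (fun θ => samplingDensity J θ y v) =ᵐ[G] univ :=
    Filter.eventuallyEq_univ.2 (hG.mono fun θ hθ => (samplingDensity_pos hJ hθ y hv).ne')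
  rw [measure_congr this]
  exact NeZero.pos _

end Bounds

/-! ### Differentiation in `y` under the mixture -/

section Derivatives

theorem hasDerivAt_samplingDensity {J : ℕ} (hJ : 1 < J) {θ : ℝ × ℝ} (hθ : 0 < θ.2) (y : ℝ) {v : ℝ}
    (hv : 0 < v) :
    HasDerivAt (fun x => samplingDensity J θ x v)
      (-(J * ((θ.2 ^ 2)⁻¹ * (y - θ.1) * samplingDensity J θ y v))) y := by
  simp_rw [samplingDensity_eq hJ hθ _ hv]
  have h : HasDerivAt (fun x : ℝ => -((θ.2 ^ 2)⁻¹ * (J * (x - θ.1) ^ 2 / 2 + shape J * v)))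
      (-((θ.2 ^ 2)⁻¹ * (J * (2 * (y - θ.1)) / 2))) y := by
    have h0 : HasDerivAt (fun x : ℝ => (x - θ.1) ^ 2) (2 * (y - θ.1)) y := by
      simpa using ((hasDerivAt_id y).sub_const θ.1).fun_pow 2
    exact ((((h0.const_mul (J : ℝ)).div_const 2).add_const _).const_mul _).neg
  refine ((h.exp.const_mul _).const_mul _).congr_deriv ?_
  ring

variable {J : ℕ} {G : Measure (ℝ × ℝ)} [IsFiniteMeasure G]

/-- Differentiating in `y` brings down `-Jτ(y - μ)`, and the bound uniform in `y` and `θ` lets a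
constant dominate. The case `r = 0` is `f`; the case `r = -1` is the numerator of `V`, where the
powers of `τ` cancel. -/
theorem hasDerivAt_integral_rpow_mul_samplingDensity (hJ : 2 < J) (hG : ∀ᵐ θ ∂G, 0 < θ.2)
    {r v : ℝ} (hr : -1 ≤ r) (hv : 0 < v) (y : ℝ) :
    HasDerivAt (fun x => ∫ θ, ((θ.2 ^ 2)⁻¹) ^ r * samplingDensity J θ x v ∂G)
      (-(J * ∫ θ, ((θ.2 ^ 2)⁻¹) ^ (r + 1) * (y - θ.1) * samplingDensity J θ y v ∂G)) y := by
  have hJ1 : (2 : ℝ) < J := by exact_mod_cast hJ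
  obtain ⟨M, hM⟩ := exists_bound_rpow_mul_abs_mul_samplingDensity (J := J) (by omega) (r := r + 1)
    (by linarith) hv
  have hmeas := fun x => measurable_samplingDensity_left J x v
  have h := hasDerivAt_integral_of_dominated_loc_of_deriv_le (μ := G) (x₀ := y) (s := univ)
    (F := fun x θ => ((θ.2 ^ 2)⁻¹) ^ r * samplingDensity J θ x v)
    (F' := fun x θ => -(J * (((θ.2 ^ 2)⁻¹) ^ (r + 1) * (x - θ.1) * samplingDensity J θ x v)))
    (bound := fun _ => J * M) Filter.univ_mem
    (Filter.Eventually.of_forall fun x => by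
      have := hmeas x
      exact Measurable.aestronglyMeasurable (by fun_prop))
    (integrable_rpow_mul_samplingDensity (by omega) hG (by linarith) hv y)
    (by have := hmeas y
        exact Measurable.aestronglyMeasurable (by fun_prop))
    (by
      filter_upwards [hG] with θ hθ x _
      have h0 := samplingDensity_nonneg (by omega : 1 < J) hθ x v
      rw [norm_neg, Real.norm_eq_abs, abs_mul, abs_mul, abs_mul, abs_of_nonneg h0,
        abs_of_nonneg (by positivity : 0 ≤ ((θ.2 ^ 2)⁻¹) ^ (r + 1)), Nat.abs_cast]
      exact mul_le_mul_of_nonneg_left (hM θ hθ x) (Nat.cast_nonneg J))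
    (integrable_const _)
    (by
      filter_upwards [hG] with θ hθ x _
      refine ((hasDerivAt_samplingDensity (by omega) hθ x hv).const_mul _).congr_deriv ?_
      rw [Real.rpow_add_one (by positivity)]
      ring)
  refine h.2.congr_deriv ?_
  rw [integral_neg, integral_const_mul]

theorem hasDerivAt_mixtureDensity (hJ : 2 < J) (hG : ∀ᵐ θ ∂G, 0 < θ.2) {v : ℝ} (hv : 0 < v)
    (y : ℝ) :
    HasDerivAt (fun x => mixtureDensity J G x v)
      (-(J * ∫ θ, (θ.2 ^ 2)⁻¹ * (y - θ.1) * samplingDensity J θ y v ∂G)) y := by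
  simpa [mixtureDensity_eq_integral] using
    hasDerivAt_integral_rpow_mul_samplingDensity hJ hG (r := 0) (by norm_num) hv y

theorem hasDerivAt_integral_snd_sq_mul_samplingDensity (hJ : 2 < J) (hG : ∀ᵐ θ ∂G, 0 < θ.2)
    {v : ℝ} (hv : 0 < v) (y : ℝ) :
    HasDerivAt (fun x => ∫ θ, θ.2 ^ 2 * samplingDensity J θ x v ∂G)
      (-(J * ∫ θ, (y - θ.1) * samplingDensity J θ y v ∂G)) y := by
  simpa [inv_sq_rpow_neg_one] using
    hasDerivAt_integral_rpow_mul_samplingDensity hJ hG (r := -1) le_rfl hv y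

end Derivatives

/-! ### Tweedie formulas for mixtures -/

section Tweedie

/-- Interchange of the mixture with an integral transform in the variance argument. -/
theorem integral_mul_mixtureDensity {J : ℕ} (hJ : 1 < J) {G : Measure (ℝ × ℝ)} [IsFiniteMeasure G]
    (hG : ∀ᵐ θ ∂G, 0 < θ.2) {y v : ℝ} {K : ℝ → ℝ} (hKm : Measurable K)
    (hK : ∀ t, v < t → 0 ≤ K t) {g : ℝ × ℝ → ℝ} (hg : Integrable g G)
    (h : ∀ θ : ℝ × ℝ, 0 < θ.2 → IntegrableOn (fun t => K t * samplingDensity J θ y t) (Ioi v) ∧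
      ∫ t in Ioi v, K t * samplingDensity J θ y t = g θ) :
    IntegrableOn (fun t => K t * mixtureDensity J G y t) (Ioi v) ∧
      ∫ t in Ioi v, K t * mixtureDensity J G y t = ∫ θ, g θ ∂G := by
  have hm : Measurable (Function.uncurry fun (θ : ℝ × ℝ) t => K t * samplingDensity J θ y t) :=
    (hKm.comp measurable_snd).mul ((measurable_samplingDensity J).fun_comp
      (f := fun p : (ℝ × ℝ) × ℝ => (p.1, (y, p.2))) (by fun_prop))
  have hint : Integrable (Function.uncurry fun (θ : ℝ × ℝ) t => K t * samplingDensity J θ y t)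
      (G.prod (volume.restrict (Ioi v))) := by
    -- The integrand is nonnegative for `t > v`, so the inner integral of its norm is `g` and
    -- integrability on the product reduces to that of `g`.
    rw [integrable_prod_iff hm.aestronglyMeasurable]
    refine ⟨hG.mono fun θ hθ => (h θ hθ).1, hg.congr ?_⟩
    filter_upwards [hG] with θ hθ
    rw [← (h θ hθ).2]
    refine setIntegral_congr_fun measurableSet_Ioi fun t ht => ?_
    exact (Real.norm_of_nonneg (mul_nonneg (hK t ht) (samplingDensity_nonneg hJ hθ y t))).symm
  have e : ∀ t, ∫ θ, K t * samplingDensity J θ y t ∂G = K t * mixtureDensity J G y t :=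
    fun t => integral_const_mul _ _
  refine ⟨?_, ?_⟩
  · exact hint.integral_prod_right.congr (ae_of_all _ fun t => e t)
  · simp_rw [← e]
    rw [← integral_integral_swap hint]
    exact integral_congr_ae (hG.mono fun θ hθ => (h θ hθ).2)

/-- The weight cancels the factor `t^(k-1)` of the density, leaving a pure exponential in `t - v`.
-/
theorem rpow_mul_samplingDensity {J : ℕ} (hJ : 1 < J) {θ : ℝ × ℝ} (hθ : 0 < θ.2) (y : ℝ)
    {v t : ℝ} (hv : 0 < v) (ht : 0 < t) :
    (v / t) ^ (shape J - 1) * samplingDensity J θ y t =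
      samplingDensity J θ y v * Real.exp (-(shape J / θ.2 ^ 2 * (t - v))) := by
  have e1 : (v / t) ^ (shape J - 1) * samplingConst J t = samplingConst J v := by
    have := (Real.rpow_pos_of_pos ht (shape J - 1)).ne'
    unfold samplingConst
    rw [Real.div_rpow hv.le ht.le]
    field_simp
  rw [samplingDensity_eq hJ hθ y hv, samplingDensity_eq hJ hθ y ht, ← mul_assoc, e1, mul_assoc,
    mul_assoc, ← Real.exp_add]
  congr 4
  field_simp
  ring

theorem integral_exp_neg_mul_sub_Ioi {r : ℝ} (hr : 0 < r) (v : ℝ) :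
    IntegrableOn (fun t => Real.exp (-(r * (t - v)))) (Ioi v) ∧
      ∫ t in Ioi v, Real.exp (-(r * (t - v))) = 1 / r := by
  have e : ∀ t, Real.exp (-(r * (t - v))) = Real.exp (r * v) * Real.exp (-r * t) := fun t => by
    rw [← Real.exp_add]; congr 1; ring
  simp_rw [e]
  refine ⟨(integrableOn_exp_mul_Ioi (by linarith) v).const_mul _, ?_⟩
  rw [integral_const_mul, integral_exp_mul_Ioi (by linarith), neg_div_neg_eq, mul_div_assoc',
    ← Real.exp_add]
  simp

theorem integral_rpow_mul_exp_neg_mul_sub_Ioi {a r : ℝ} (ha : 0 < a) (hr : 0 < r) (v : ℝ) :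
    IntegrableOn (fun t => (t - v) ^ (a - 1) * Real.exp (-(r * (t - v)))) (Ioi v) ∧
      ∫ t in Ioi v, (t - v) ^ (a - 1) * Real.exp (-(r * (t - v))) = (1 / r) ^ a * Real.Gamma a := by
  have hp : MeasurePreserving (fun t : ℝ => t - v) volume volume := measurePreserving_sub_right _ v
  have he : MeasurableEmbedding (fun t : ℝ => t - v) := measurableEmbedding_subRight v
  have hpre : (fun t : ℝ => t - v) ⁻¹' (Ioi 0) = Ioi v := by ext; simp
  have h2 := Real.integral_rpow_mul_exp_neg_mul_Ioi ha hr
  have h1 : IntegrableOn (fun t : ℝ => t ^ (a - 1) * Real.exp (-(r * t))) (Ioi 0) := by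
    -- A nonintegrable function has integral `0` by convention, so the nonzero value in `h2` proves
    -- integrability.
    refine not_imp_comm.1 integral_undef ?_
    rw [h2]
    have := Real.Gamma_pos_of_pos ha
    positivity
  refine ⟨?_, ?_⟩
  · have := (hp.integrableOn_comp_preimage he).2 h1
    rwa [hpre] at this
  · have := hp.setIntegral_preimage_emb he (fun t => t ^ (a - 1) * Real.exp (-(r * t))) (Ioi 0)
    rw [hpre, h2] at this
    exact this

variable {J : ℕ} {G : Measure (ℝ × ℝ)} [IsProbabilityMeasure G]

/-- For each `θ`, `∫_v^∞ exp(-k(t - v)/σ²) dt = σ²/k`; integrate this over the prior. -/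
theorem tweedieVar_mixtureDensity (hJ : 2 < J) (hG : ∀ᵐ θ ∂G, 0 < θ.2) {v : ℝ} (hv : 0 < v)
    (y : ℝ) :
    IntegrableOn (tweedieVarIntegrand J (mixtureDensity J G) y v) (Ioi v) ∧
      tweedieVar J (mixtureDensity J G) y v =
        (∫ θ, θ.2 ^ 2 * samplingDensity J θ y v ∂G) / mixtureDensity J G y v := by
  have hJ' : 1 < J := by omega
  have hk := shape_pos hJ'
  have h := integral_mul_mixtureDensity hJ' hG (y := y) (v := v)
    (K := fun t => (v / t) ^ (shape J - 1)) (by fun_prop)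
    (fun t ht => by have := hv.trans ht; positivity)
    ((integrable_snd_sq_mul_samplingDensity hJ hG hv y).const_mul (1 / shape J))
    (fun θ hθ => by
      have h0 := integral_exp_neg_mul_sub_Ioi (r := shape J / θ.2 ^ 2) (by positivity) v
      have e : EqOn (fun t => (v / t) ^ (shape J - 1) * samplingDensity J θ y t)
          (fun t => samplingDensity J θ y v * Real.exp (-(shape J / θ.2 ^ 2 * (t - v)))) (Ioi v) :=
        fun t ht => rpow_mul_samplingDensity hJ' hθ y hv (hv.trans ht)
      refine ⟨IntegrableOn.congr_fun (h0.1.const_mul _) e.symm measurableSet_Ioi, ?_⟩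
      rw [setIntegral_congr_fun measurableSet_Ioi e, integral_const_mul, h0.2]
      field_simp)
  have e : tweedieVarIntegrand J (mixtureDensity J G) y v = fun t =>
      (v / t) ^ (shape J - 1) * mixtureDensity J G y t * (mixtureDensity J G y v)⁻¹ := by
    ext t
    rw [tweedieVarIntegrand]
    ring
  rw [tweedieVar, e]
  refine ⟨h.1.mul_const _, ?_⟩
  rw [integral_mul_const, h.2, integral_const_mul]
  field_simp

/-- The gamma integral with exponent `1/2` gives `Γ(1/2) σ/√k`; the weight supplies the other
`1/√k`. -/
theorem tweedieSd_mixtureDensity (hJ : 1 < J) (hG : ∀ᵐ θ ∂G, 0 < θ.2) {v : ℝ} (hv : 0 < v)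
    (y : ℝ) :
    IntegrableOn (tweedieSdIntegrand J (mixtureDensity J G) y v) (Ioi v) ∧
      tweedieSd J (mixtureDensity J G) y v =
        (∫ θ, θ.2 * samplingDensity J θ y v ∂G) / mixtureDensity J G y v := by
  have hk := shape_pos hJ
  have hΓ : 0 < Real.Gamma (1 / 2) := Real.Gamma_pos_of_pos (by norm_num)
  have h := integral_mul_mixtureDensity hJ hG (y := y) (v := v)
    (K := fun t => 1 / Real.sqrt (shape J * (t - v)) * (v / t) ^ (shape J - 1)) (by fun_prop)
    (fun t ht => by have := hv.trans ht; positivity)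
    ((integrable_snd_mul_samplingDensity hJ hG hv y).const_mul (Real.Gamma (1 / 2) / shape J))
    (fun θ hθ => by
      have h0 := integral_rpow_mul_exp_neg_mul_sub_Ioi (a := 1 / 2) (r := shape J / θ.2 ^ 2)
        (by norm_num) (by positivity) v
      have e : EqOn (fun t => 1 / Real.sqrt (shape J * (t - v)) * (v / t) ^ (shape J - 1) *
            samplingDensity J θ y t)
          (fun t => samplingDensity J θ y v / Real.sqrt (shape J) * ((t - v) ^ ((1 : ℝ) / 2 - 1) *
            Real.exp (-(shape J / θ.2 ^ 2 * (t - v))))) (Ioi v) := by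
        intro t ht
        have ht : v < t := ht
        have htv : 0 < t - v := sub_pos.2 ht
        dsimp only
        rw [mul_assoc, rpow_mul_samplingDensity hJ hθ y hv (hv.trans ht), Real.sqrt_mul hk.le,
          Real.rpow_sub_one htv.ne', ← Real.sqrt_eq_rpow]
        have : Real.sqrt (t - v) / (t - v) = (Real.sqrt (t - v))⁻¹ := Real.sqrt_div_self'.trans
          (one_div _)
        rw [this]
        field_simp
      refine ⟨IntegrableOn.congr_fun (h0.1.const_mul _) e.symm measurableSet_Ioi, ?_⟩
      rw [setIntegral_congr_fun measurableSet_Ioi e, integral_const_mul, h0.2,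
        ← Real.sqrt_eq_rpow, one_div_div, Real.sqrt_div' _ hk.le, Real.sqrt_sq hθ.le]
      have := Real.mul_self_sqrt hk.le
      have h3 := Real.sqrt_pos.2 hk
      field_simp
      rw [Real.sq_sqrt hk.le])
  have e : tweedieSdIntegrand J (mixtureDensity J G) y v = fun t =>
      1 / Real.sqrt (shape J * (t - v)) * (v / t) ^ (shape J - 1) * mixtureDensity J G y t *
        (mixtureDensity J G y v)⁻¹ := by
    ext t
    rw [tweedieSdIntegrand]
    ring
  rw [tweedieSd, e]
  refine ⟨h.1.mul_const _, ?_⟩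
  rw [integral_mul_const, h.2, integral_const_mul]
  field_simp

theorem hasDerivAt_tweedieVar (hJ : 2 < J) (hG : ∀ᵐ θ ∂G, 0 < θ.2) {v : ℝ} (hv : 0 < v) (y : ℝ) :
    HasDerivAt (fun x => tweedieVar J (mixtureDensity J G) x v)
      ((-(J * ∫ θ, (y - θ.1) * samplingDensity J θ y v ∂G) * mixtureDensity J G y v -
        (∫ θ, θ.2 ^ 2 * samplingDensity J θ y v ∂G) *
          (-(J * ∫ θ, (θ.2 ^ 2)⁻¹ * (y - θ.1) * samplingDensity J θ y v ∂G))) /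
        mixtureDensity J G y v ^ 2) y := by
  have e : (fun x => tweedieVar J (mixtureDensity J G) x v) =
      fun x => (∫ θ, θ.2 ^ 2 * samplingDensity J θ x v ∂G) / mixtureDensity J G x v :=
    funext fun x => (tweedieVar_mixtureDensity hJ hG hv x).2
  rw [e]
  exact (hasDerivAt_integral_snd_sq_mul_samplingDensity hJ hG hv y).div
    (hasDerivAt_mixtureDensity hJ hG hv y) (mixtureDensity_pos (by omega) hG y hv).ne'

/-- From `V f = ∫ σ² p dG` one gets `V f' + V' f = -J (y f - ∫ μ p dG)`; divide by `J f`. -/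
theorem tweedieMean_mixtureDensity (hJ : 2 < J) (hG : ∀ᵐ θ ∂G, 0 < θ.2) {v : ℝ} (hv : 0 < v)
    (y : ℝ) :
    tweedieMean J (mixtureDensity J G) y v =
      (∫ θ, θ.1 * samplingDensity J θ y v ∂G) / mixtureDensity J G y v := by
  have hJ' : 1 < J := by omega
  have hJ0 : (J : ℝ) ≠ 0 := by positivity
  have hf := mixtureDensity_pos hJ' hG y hv
  have e : ∫ θ, (y - θ.1) * samplingDensity J θ y v ∂G =
      y * mixtureDensity J G y v - ∫ θ, θ.1 * samplingDensity J θ y v ∂G := by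
    simp_rw [sub_mul]
    rw [integral_sub ((integrable_samplingDensity hJ' hG hv y).const_mul y)
      (integrable_fst_mul_samplingDensity hJ' hG hv y), integral_const_mul]
    rfl
  rw [tweedieMean, (hasDerivAt_tweedieVar hJ hG hv y).deriv,
    ((hasDerivAt_mixtureDensity hJ hG hv y).log hf.ne').deriv,
    (tweedieVar_mixtureDensity hJ hG hv y).2, e]
  field_simp
  ring

theorem tweedieWellDefined_mixtureDensity (hJ : 2 < J) (hG : ∀ᵐ θ ∂G, 0 < θ.2) :
    TweedieWellDefined J (mixtureDensity J G) := fun y v hv =>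
  ⟨mixtureDensity_pos (by omega) hG y hv,
    (hasDerivAt_mixtureDensity hJ hG hv y).differentiableAt,
    (hasDerivAt_tweedieVar hJ hG hv y).differentiableAt,
    (tweedieVar_mixtureDensity hJ hG hv y).1,
    (tweedieSd_mixtureDensity (by omega) hG hv y).1⟩

/-- The integrals use only `t > v > 0`, and the derivatives are taken in `y` at fixed `v`, so
agreement on the open half-plane suffices. -/
theorem tweedieQuantile_congr {α : ℝ} {f g : ℝ → ℝ → ℝ} (h : ∀ y v, 0 < v → f y v = g y v)
    (y : ℝ) {v : ℝ} (hv : 0 < v) : tweedieQuantile J α f y v = tweedieQuantile J α g y v := by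
  have hV : ∀ x, tweedieVar J f x v = tweedieVar J g x v := fun x => by
    unfold tweedieVar
    congr 1
    refine setIntegral_congr_fun measurableSet_Ioi fun t ht => ?_
    simp only [tweedieVarIntegrand, h x v hv, h x t (hv.trans ht)]
  have hS : tweedieSd J f y v = tweedieSd J g y v := by
    unfold tweedieSd
    congr 1
    refine setIntegral_congr_fun measurableSet_Ioi fun t ht => ?_
    simp only [tweedieSdIntegrand, h y v hv, h y t (hv.trans ht)]
  simp only [tweedieQuantile, tweedieMean, hV, hS, fun x => h x v hv]

end Tweedie

/-! ### The marginal law of mean and variance -/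

section Law

theorem mixtureDensity_nonneg {J : ℕ} (hJ : 1 < J) {G : Measure (ℝ × ℝ)} (hG : ∀ᵐ θ ∂G, 0 < θ.2) (y v : ℝ) :
    0 ≤ mixtureDensity J G y v :=
  integral_nonneg_of_ae (hG.mono fun _ hθ => samplingDensity_nonneg hJ hθ y v)

theorem lintegral_unitLaw {J : ℕ} {G : Measure (ℝ × ℝ)} [SFinite G] {F : (ℝ × ℝ) × (Fin J → ℝ) → ℝ≥0∞} (hF : Measurable F) :
    ∫⁻ ω, F ω ∂(unitLaw J G) = ∫⁻ θ, ∫⁻ ε, F (θ, ε) ∂(unitNoise J) ∂G :=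
  lintegral_prod _ hF.aemeasurable

variable {J : ℕ} {G : Measure (ℝ × ℝ)} [IsProbabilityMeasure G]

theorem measurable_mixtureDensity (J : ℕ) (G : Measure (ℝ × ℝ)) [SFinite G] :
    Measurable fun p : ℝ × ℝ => mixtureDensity J G p.1 p.2 := by
  have h : StronglyMeasurable (Function.uncurry fun (p θ : ℝ × ℝ) => samplingDensity J θ p.1 p.2) :=
    ((measurable_samplingDensity J).fun_comp measurable_swap).stronglyMeasurable
  exact h.integral_prod_right.measurable

theorem samplingDensity_of_neg (J : ℕ) (θ : ℝ × ℝ) (y : ℝ) {v : ℝ} (hv : v < 0) :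
    samplingDensity J θ y v = 0 := by
  rw [samplingDensity, gammaPDFReal, if_neg hv.not_ge, mul_zero]

theorem ae_snd_ne_zero : ∀ᵐ p : ℝ × ℝ, p.2 ≠ 0 :=
  Measure.quasiMeasurePreserving_snd.ae (measure_eq_zero_iff_ae_notMem.1 Real.volume_singleton)

/-- Both sides vanish for `v < 0`, and integrability gives the case `v > 0`. The excluded line `v =
0` is Lebesgue null. -/
theorem lintegral_samplingDensity (hJ : 1 < J) (hG : ∀ᵐ θ ∂G, 0 < θ.2) (y : ℝ) {v : ℝ}
    (hv : v ≠ 0) :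
    ∫⁻ θ, ENNReal.ofReal (samplingDensity J θ y v) ∂G = ENNReal.ofReal (mixtureDensity J G y v) := by
  rcases hv.lt_or_gt with h | h
  · simp [mixtureDensity_eq_integral, samplingDensity_of_neg J _ y h]
  · exact (ofReal_integral_eq_lintegral_ofReal (integrable_samplingDensity hJ hG h y)
      (hG.mono fun θ hθ => samplingDensity_nonneg hJ hθ y v)).symm

theorem measurable_meanVar (J : ℕ) : Measurable fun ω : (ℝ × ℝ) × (Fin J → ℝ) =>
    (sampleMean (unitData ω.1 ω.2), sampleVar (unitData ω.1 ω.2)) :=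
  ((measurable_sampleMean J).fun_comp (measurable_unitData J)).prodMk
    ((measurable_sampleVar J).fun_comp (measurable_unitData J))

/-- The mixture density is the density of (sample mean, sample variance). -/
theorem map_meanVar_unitLaw (hJ : 1 < J) (hG : ∀ᵐ θ ∂G, 0 < θ.2) :
    (unitLaw J G).map (fun ω => (sampleMean (unitData ω.1 ω.2), sampleVar (unitData ω.1 ω.2))) =
      volume.withDensity fun p : ℝ × ℝ => ENNReal.ofReal (mixtureDensity J G p.1 p.2) := by
  have hm : Measurable fun q : (ℝ × ℝ) × (ℝ × ℝ) =>
      ENNReal.ofReal (samplingDensity J q.1 q.2.1 q.2.2) :=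
    (measurable_samplingDensity J).ennreal_ofReal
  ext s hs
  rw [withDensity_apply _ hs, ← lintegral_indicator_one hs, lintegral_map
    (measurable_one.indicator hs) (measurable_meanVar J), lintegral_unitLaw
    ((measurable_one.indicator hs).fun_comp (measurable_meanVar J))]
  have h1 : ∀ᵐ θ ∂G, ∫⁻ ε, s.indicator (1 : ℝ × ℝ → ℝ≥0∞)
      (sampleMean (unitData θ ε), sampleVar (unitData θ ε)) ∂(unitNoise J) =
      ∫⁻ p in s, ENNReal.ofReal (samplingDensity J θ p.1 p.2) := by
    filter_upwards [hG] with θ hθ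
    have hmθ : Measurable fun ε : Fin J → ℝ =>
        (sampleMean (unitData θ ε), sampleVar (unitData θ ε)) :=
      (measurable_meanVar J).fun_comp measurable_prodMk_left
    rw [← lintegral_map (measurable_one.indicator hs) hmθ, lintegral_indicator_one hs,
      map_sampleMean_sampleVar_unitData hJ hθ, withDensity_apply _ hs]
  rw [lintegral_congr_ae h1, lintegral_lintegral_swap hm.aemeasurable]
  refine lintegral_congr_ae (ae_restrict_of_ae ?_)
  filter_upwards [ae_snd_ne_zero] with p hp
  exact lintegral_samplingDensity hJ hG p.1 hp

theorem ae_sampleVar_pos_unitNoise (hJ : 1 < J) {θ : ℝ × ℝ} (hθ : 0 < θ.2) :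
    ∀ᵐ ε ∂(unitNoise J), 0 < sampleVar (unitData θ ε) := by
  have hmθ : Measurable fun ε : Fin J → ℝ =>
      (sampleMean (unitData θ ε), sampleVar (unitData θ ε)) :=
    (measurable_meanVar J).fun_comp measurable_prodMk_left
  refine ae_of_ae_map (p := fun p : ℝ × ℝ => 0 < p.2) hmθ.aemeasurable ?_
  rw [map_sampleMean_sampleVar_unitData hJ hθ, ae_withDensity_iff
    ((measurable_samplingDensity J).ennreal_ofReal.fun_comp measurable_prodMk_left)]
  filter_upwards [ae_snd_ne_zero] with p hp h
  by_contra h0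
  exact h (by rw [samplingDensity_of_neg J θ p.1 (lt_of_le_of_ne (not_lt.1 h0) hp)]; simp)

theorem measurable_unitData_right (θ : ℝ × ℝ) :
    Measurable (unitData θ : (Fin J → ℝ) → (Fin J → ℝ)) :=
  (measurable_unitData J).fun_comp measurable_prodMk_left

theorem measurable_ofReal_dataDensity (θ : ℝ × ℝ) :
    Measurable fun x : Fin J → ℝ => ENNReal.ofReal (dataDensity θ x) :=
  ((measurable_dataDensity J).fun_comp measurable_prodMk_left).ennreal_ofReal

/-- The data law at `(μ, σ) = (0, 1)` has a positive density, so its null sets are Lebesgue null. -/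
theorem ae_sampleVar_pos (hJ : 1 < J) : ∀ᵐ x : Fin J → ℝ, 0 < sampleVar x := by
  have h1 : (0 : ℝ) < ((0, 1) : ℝ × ℝ).2 := one_pos
  have h := map_unitData (J := J) h1
  have hac : (volume : Measure (Fin J → ℝ)) ≪ (unitNoise J).map (unitData (0, 1)) := by
    rw [h]
    exact withDensity_absolutelyContinuous' (measurable_ofReal_dataDensity _).aemeasurable
      (ae_of_all _ fun x => (ENNReal.ofReal_pos.2 (dataDensity_pos h1 x)).ne')
  refine hac.ae_le ((ae_map_iff (measurable_unitData_right _).aemeasurable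
    (measurableSet_lt measurable_const (measurable_sampleVar J))).2 ?_)
  exact ae_sampleVar_pos_unitNoise hJ h1

end Law

/-! ### Bayes' formula and the conditional distribution -/

section Bayes

/-- Sample mean and sample standard deviation. -/
noncomputable def meanSd {J : ℕ} (x : Fin J → ℝ) : ℝ × ℝ := (sampleMean x, sampleSd x)

theorem measurable_meanSd (J : ℕ) : Measurable (meanSd : (Fin J → ℝ) → ℝ × ℝ) :=
  (measurable_sampleMean J).prodMk (measurable_sampleSd J)

/-- Density of the posterior given by Bayes' formula with respect to the prior. -/
noncomputable def bayesDensity (J : ℕ) (G : Measure (ℝ × ℝ)) (t θ : ℝ × ℝ) : ℝ≥0∞ :=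
  ENNReal.ofReal (samplingDensity J θ t.1 (t.2 ^ 2) / mixtureDensity J G t.1 (t.2 ^ 2))

/-- Posterior given by Bayes' formula. -/
noncomputable def bayesKernel (J : ℕ) (G : Measure (ℝ × ℝ)) [IsProbabilityMeasure G] :
    Kernel (ℝ × ℝ) (ℝ × ℝ) :=
  Kernel.withDensity (Kernel.const _ G) (bayesDensity J G)

theorem bayesDensity_lt_top (J : ℕ) (G : Measure (ℝ × ℝ)) (t θ : ℝ × ℝ) : bayesDensity J G t θ < ∞ := ENNReal.ofReal_lt_top

theorem bayesDensity_toReal {J : ℕ} {G : Measure (ℝ × ℝ)} (hJ : 1 < J) (hG : ∀ᵐ θ ∂G, 0 < θ.2) (t : ℝ × ℝ) {θ : ℝ × ℝ}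
    (hθ : 0 < θ.2) : (bayesDensity J G t θ).toReal =
      samplingDensity J θ t.1 (t.2 ^ 2) / mixtureDensity J G t.1 (t.2 ^ 2) :=
  ENNReal.toReal_ofReal (div_nonneg (samplingDensity_nonneg hJ hθ _ _)
    (mixtureDensity_nonneg hJ hG _ _))

variable {J : ℕ} {G : Measure (ℝ × ℝ)} [IsProbabilityMeasure G]

theorem measurable_bayesDensity (J : ℕ) (G : Measure (ℝ × ℝ)) [IsProbabilityMeasure G] :
    Measurable (Function.uncurry (bayesDensity J G)) := by
  have h1 : Measurable fun p : (ℝ × ℝ) × (ℝ × ℝ) => samplingDensity J p.2 p.1.1 (p.1.2 ^ 2) :=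
    (measurable_samplingDensity J).fun_comp
      (f := fun p : (ℝ × ℝ) × (ℝ × ℝ) => (p.2, (p.1.1, p.1.2 ^ 2))) (by fun_prop)
  have h2 : Measurable fun p : (ℝ × ℝ) × (ℝ × ℝ) => mixtureDensity J G p.1.1 (p.1.2 ^ 2) :=
    (measurable_mixtureDensity J G).fun_comp
      (f := fun p : (ℝ × ℝ) × (ℝ × ℝ) => (p.1.1, p.1.2 ^ 2)) (by fun_prop)
  exact (h1.div h2).ennreal_ofReal

theorem measurable_bayesDensity_right (t : ℝ × ℝ) : Measurable (bayesDensity J G t) :=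
  Measurable.of_uncurry_left (measurable_bayesDensity J G)

theorem bayesKernel_apply (t : ℝ × ℝ) : bayesKernel J G t = G.withDensity (bayesDensity J G t) := by
  rw [bayesKernel, Kernel.withDensity_apply _ (measurable_bayesDensity J G), Kernel.const_apply]

/-- Only an inequality, because it must hold at every `t`: where `f` vanishes, or is `0` by
convention for lack of integrability, division by zero gives the zero kernel. -/
theorem lintegral_bayesDensity_le_one (hJ : 1 < J) (hG : ∀ᵐ θ ∂G, 0 < θ.2) (t : ℝ × ℝ) :
    ∫⁻ θ, bayesDensity J G t θ ∂G ≤ 1 := by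
  have hf := mixtureDensity_nonneg hJ hG t.1 (t.2 ^ 2)
  by_cases hi : Integrable (fun θ => samplingDensity J θ t.1 (t.2 ^ 2)) G
  · unfold bayesDensity
    rw [← ofReal_integral_eq_lintegral_ofReal (hi.div_const _)
      (hG.mono fun θ hθ => div_nonneg (samplingDensity_nonneg hJ hθ _ _) hf), integral_div,
      ← mixtureDensity_eq_integral, ENNReal.ofReal_le_one]
    exact div_self_le_one _
  · simp [bayesDensity, mixtureDensity_eq_integral, integral_undef hi]

theorem isFiniteKernel_bayesKernel (hJ : 1 < J) (hG : ∀ᵐ θ ∂G, 0 < θ.2) :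
    IsFiniteKernel (bayesKernel J G) :=
  ⟨1, ENNReal.one_lt_top, fun t => by
    rw [bayesKernel_apply, withDensity_apply _ MeasurableSet.univ, setLIntegral_univ]
    exact lintegral_bayesDensity_le_one hJ hG t⟩

theorem lintegral_comp_unitData {θ : ℝ × ℝ} (hθ : 0 < θ.2) {H : (Fin J → ℝ) → ℝ≥0∞}
    (hH : Measurable H) :
    ∫⁻ ε, H (unitData θ ε) ∂(unitNoise J) = ∫⁻ x, ENNReal.ofReal (dataDensity θ x) * H x := by
  rw [← lintegral_map hH (measurable_unitData_right θ), map_unitData hθ,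
    lintegral_withDensity_eq_lintegral_mul _ (measurable_ofReal_dataDensity θ) hH]
  rfl

theorem lintegral_lintegral_unitData (hG : ∀ᵐ θ ∂G, 0 < θ.2)
    {F : (Fin J → ℝ) × (ℝ × ℝ) → ℝ≥0∞} (hF : Measurable F) :
    ∫⁻ θ, ∫⁻ ε, F (unitData θ ε, θ) ∂(unitNoise J) ∂G =
      ∫⁻ x, ∫⁻ θ, ENNReal.ofReal (dataDensity θ x) * F (x, θ) ∂G := by
  rw [lintegral_congr_ae (hG.mono fun θ hθ => lintegral_comp_unitData hθ
    (hF.fun_comp measurable_prodMk_right))]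
  refine lintegral_lintegral_swap (Measurable.aemeasurable ?_)
  exact (measurable_dataDensity J).ennreal_ofReal.mul (hF.fun_comp measurable_swap)

theorem sampleSd_sq {x : Fin J → ℝ} (hv : 0 < sampleVar x) : sampleSd x ^ 2 = sampleVar x :=
  Real.sq_sqrt hv.le

/-- Bayes' formula: given the data of one unit, the parameter has law `bayesKernel`. -/
theorem lintegral_bayesKernel (hJ : 1 < J) (hG : ∀ᵐ θ ∂G, 0 < θ.2)
    {F : (Fin J → ℝ) × (ℝ × ℝ) → ℝ≥0∞} (hF : Measurable F) :
    ∫⁻ θ, ∫⁻ ε, F (unitData θ ε, θ) ∂(unitNoise J) ∂G =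
      ∫⁻ θ, ∫⁻ ε, ∫⁻ t, F (unitData θ ε, t) ∂(bayesKernel J G (meanSd (unitData θ ε)))
        ∂(unitNoise J) ∂G := by
  have := isFiniteKernel_bayesKernel hJ hG
  have hΦ : Measurable fun x : Fin J → ℝ => ∫⁻ t, F (x, t) ∂(bayesKernel J G (meanSd x)) :=
    Measurable.lintegral_kernel_prod_right' (κ := (bayesKernel J G).comap meanSd
      (measurable_meanSd J)) hF
  rw [lintegral_lintegral_unitData hG hF, lintegral_lintegral_unitData hG
    (F := fun p => ∫⁻ t, F (p.1, t) ∂(bayesKernel J G (meanSd p.1))) (hΦ.fun_comp measurable_fst)]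
  refine lintegral_congr_ae ?_
  filter_upwards [ae_sampleVar_pos hJ] with x hx
  have hf := mixtureDensity_pos hJ hG (sampleMean x) hx
  -- By sufficiency this factor is free of `θ`, so it occurs on both sides of Bayes' formula.
  set c := ((Real.sqrt (2 * Real.pi))⁻¹) ^ J / samplingConst J (sampleVar x) with hc
  have hc0 : 0 ≤ c := div_nonneg (by positivity) (samplingConst_pos hJ hx).le
  have hh : ∀ᵐ θ ∂G, ENNReal.ofReal (dataDensity θ x) =
      ENNReal.ofReal c * ENNReal.ofReal (samplingDensity J θ (sampleMean x) (sampleVar x)) := by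
    filter_upwards [hG] with θ hθ
    rw [dataDensity_eq hJ hθ x hx, ENNReal.ofReal_mul hc0]
  have hFx : Measurable fun t => F (x, t) := hF.fun_comp measurable_prodMk_left
  have hbm := measurable_bayesDensity_right (J := J) (G := G) (meanSd x)
  have hsm : Measurable fun θ => ENNReal.ofReal
      (samplingDensity J θ (sampleMean x) (sampleVar x)) :=
    (measurable_samplingDensity_left J _ _).ennreal_ofReal
  rw [bayesKernel_apply, lintegral_withDensity_eq_lintegral_mul _ hbm hFx]
  have h2 : ∫⁻ θ, ENNReal.ofReal (dataDensity θ x) ∂G =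
      ENNReal.ofReal c * ENNReal.ofReal (mixtureDensity J G (sampleMean x) (sampleVar x)) := by
    rw [lintegral_congr_ae hh, lintegral_const_mul _ hsm, lintegral_samplingDensity hJ hG _ hx.ne']
  rw [lintegral_mul_const _ ((measurable_dataDensity J).fun_comp
    measurable_prodMk_right).ennreal_ofReal, h2, ← lintegral_const_mul _ (hbm.mul hFx)]
  refine lintegral_congr_ae (hh.mono fun θ hθ => ?_)
  dsimp only
  rw [hθ, Pi.mul_apply, ← mul_assoc]
  congr 1
  rw [mul_assoc, bayesDensity, ← ENNReal.ofReal_mul hf.le]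
  congr 2
  simp only [meanSd, sampleSd_sq hx]
  field_simp

theorem measurable_meanSd_unitData (J : ℕ) :
    Measurable fun ω : (ℝ × ℝ) × (Fin J → ℝ) => meanSd (unitData ω.1 ω.2) :=
  (measurable_meanSd J).fun_comp (measurable_unitData J)

/-- Conditional distributions are unique almost surely, so it suffices that both kernels yield the
same joint law; this is Bayes' formula for test functions of `(meanSd x, θ)`. -/
theorem posterior_ae_eq_bayesKernel (hJ : 1 < J) (hG : ∀ᵐ θ ∂G, 0 < θ.2) :
    posterior J G =ᵐ[(unitLaw J G).map fun ω => meanSd (unitData ω.1 ω.2)] bayesKernel J G := by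
  have := isFiniteKernel_bayesKernel hJ hG
  have hT := measurable_meanSd_unitData J
  refine condDistrib_ae_eq_of_measure_eq_compProd_of_measurable hT measurable_fst ?_
  ext s hs
  have hT' : Measurable fun p : (Fin J → ℝ) × (ℝ × ℝ) => (meanSd p.1, p.2) :=
    ((measurable_meanSd J).fun_comp measurable_fst).prodMk measurable_snd
  have hm1 : Measurable (s.indicator (1 : (ℝ × ℝ) × (ℝ × ℝ) → ℝ≥0∞)) := measurable_one.indicator hs
  rw [← lintegral_indicator_one hs, ← lintegral_indicator_one hs,
    lintegral_map hm1 (hT.prodMk measurable_fst), Measure.lintegral_compProd hm1,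
    lintegral_map hm1.lintegral_kernel_prod_right' hT,
    lintegral_unitLaw (hm1.fun_comp (hT.prodMk measurable_fst)),
    lintegral_unitLaw (hm1.lintegral_kernel_prod_right'.fun_comp hT)]
  exact lintegral_bayesKernel hJ hG (hm1.fun_comp hT')

theorem ae_posterior_eq (hJ : 1 < J) (hG : ∀ᵐ θ ∂G, 0 < θ.2) :
    ∀ᵐ t ∂((unitLaw J G).map fun ω => meanSd (unitData ω.1 ω.2)),
      0 < t.2 ∧ posterior J G t = bayesKernel J G t := by
  refine Filter.Eventually.and ?_ (posterior_ae_eq_bayesKernel hJ hG)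
  have hs : MeasurableSet {t : ℝ × ℝ | 0 < t.2} := measurableSet_lt measurable_const measurable_snd
  rw [ae_map_iff (measurable_meanSd_unitData J).aemeasurable hs, unitLaw]
  refine (Measure.ae_prod_iff_ae_ae (measurable_meanSd_unitData J hs)).2 ?_
  filter_upwards [hG] with θ hθ
  filter_upwards [ae_sampleVar_pos_unitNoise hJ hθ] with ε hε
  exact Real.sqrt_pos.2 hε

theorem integrable_bayesKernel (hJ : 1 < J) (hG : ∀ᵐ θ ∂G, 0 < θ.2) (t : ℝ × ℝ) {g : ℝ × ℝ → ℝ}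
    (hg : Integrable (fun θ => g θ * samplingDensity J θ t.1 (t.2 ^ 2)) G) :
    Integrable g (bayesKernel J G t) := by
  rw [bayesKernel_apply, integrable_withDensity_iff
    (measurable_bayesDensity_right t)
    (ae_of_all _ fun θ => bayesDensity_lt_top J G t θ)]
  refine (hg.div_const (mixtureDensity J G t.1 (t.2 ^ 2))).congr ?_
  filter_upwards [hG] with θ hθ
  rw [bayesDensity_toReal hJ hG t hθ, mul_div_assoc]

theorem integral_bayesKernel (hJ : 1 < J) (hG : ∀ᵐ θ ∂G, 0 < θ.2) (t : ℝ × ℝ) (g : ℝ × ℝ → ℝ) :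
    ∫ θ, g θ ∂(bayesKernel J G t) =
      (∫ θ, g θ * samplingDensity J θ t.1 (t.2 ^ 2) ∂G) / mixtureDensity J G t.1 (t.2 ^ 2) := by
  rw [bayesKernel_apply, integral_withDensity_eq_integral_toReal_smul
    (measurable_bayesDensity_right t)
    (ae_of_all _ fun θ => bayesDensity_lt_top J G t θ), ← integral_div]
  refine integral_congr_ae ?_
  filter_upwards [hG] with θ hθ
  rw [bayesDensity_toReal hJ hG t hθ, smul_eq_mul]
  ring

/-- A property that holds almost surely for (sample mean, sample standard deviation) holds
Lebesgue almost everywhere on `ℝ × (0, ∞)`. -/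
theorem ae_volume_of_ae_map_meanSd (hJ : 1 < J) (hG : ∀ᵐ θ ∂G, 0 < θ.2) {P : ℝ × ℝ → Prop}
    (h : ∀ᵐ t ∂((unitLaw J G).map fun ω => meanSd (unitData ω.1 ω.2)), P t) :
    ∀ᵐ p : ℝ × ℝ, 0 < p.2 → P p := by
  have hφ : Measurable fun p : ℝ × ℝ => (p.1, Real.sqrt p.2) := by fun_prop
  have e : (unitLaw J G).map (fun ω => meanSd (unitData ω.1 ω.2)) =
      (volume.withDensity fun p : ℝ × ℝ => ENNReal.ofReal (mixtureDensity J G p.1 p.2)).map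
        fun p => (p.1, Real.sqrt p.2) := by
    rw [← map_meanVar_unitLaw hJ hG, Measure.map_map hφ (measurable_meanVar J)]
    rfl
  rw [e] at h
  have h1 := ae_of_ae_map hφ.aemeasurable h
  rw [ae_withDensity_iff (measurable_mixtureDensity J G).ennreal_ofReal] at h1
  -- Positivity of `f` on `v > 0` upgrades null for the data law to Lebesgue null.
  have h2 : volume {p : ℝ × ℝ | 0 < p.2 ∧ ¬ P (p.1, Real.sqrt p.2)} = 0 := by
    refine measure_mono_null ?_ (ae_iff.1 h1)
    rintro p ⟨hp, hP⟩ hcon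
    exact hP (hcon (ENNReal.ofReal_pos.2 (mixtureDensity_pos hJ hG p.1 hp)).ne')
  -- Passing from `v = s²` to `s` preserves null sets, as the square root is differentiable on `v >
  -- 0`.
  have h3 := addHaar_image_eq_zero_of_differentiableOn_of_addHaar_eq_zero
    (volume : Measure (ℝ × ℝ)) (f := fun p : ℝ × ℝ => (p.1, Real.sqrt p.2))
    (s := {p : ℝ × ℝ | 0 < p.2 ∧ ¬ P (p.1, Real.sqrt p.2)})
    (fun p hp => (differentiableAt_fst.prodMk
      (differentiableAt_snd.sqrt hp.1.ne')).differentiableWithinAt) h2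
  refine measure_mono_null ?_ h3
  intro p hp
  simp only [mem_compl_iff, mem_ofPred_eq, Classical.not_imp] at hp
  refine ⟨(p.1, p.2 ^ 2), ⟨pow_pos hp.1 2, ?_⟩, ?_⟩
  · simpa [Real.sqrt_sq hp.1.le] using hp.2
  · simp [Real.sqrt_sq hp.1.le]

end Bayes

/-! ### Normal quantiles -/

section Quantile

theorem cdf_gaussianReal_eq {σ : ℝ} (hσ : 0 < σ) (μ y : ℝ) :
    cdf (gaussianReal μ (σ ^ 2).toNNReal) y = cdf (gaussianReal 0 1) ((y - μ) / σ) := by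
  have h2 : IsProbabilityMeasure ((gaussianReal 0 1).map (fun x => μ + σ * x)) :=
    Measure.isProbabilityMeasure_map (by fun_prop)
  rw [← gaussianReal_map_affine, cdf_eq_real, cdf_eq_real, map_measureReal_apply (by fun_prop) measurableSet_Iic]
  congr 1
  ext x
  simp only [mem_preimage, mem_Iic, le_div_iff₀ hσ]
  constructor <;> intro h <;> linarith

/-- The superlevel set of the distribution function is an increasing affine image of the standard
one, and such maps commute with infima. Here `α < 1` makes the set nonempty and `α > 0` bounds it
below. -/
theorem normalQuantile_eq {α : ℝ} (hα : α ∈ Ioo (0 : ℝ) 1) (μ : ℝ) {σ : ℝ} (hσ : 0 < σ) :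
    normalQuantile μ σ α = μ + σ * stdNormalQuantile α := by
  set A := {x : ℝ | α ≤ cdf (gaussianReal 0 1) x} with hA
  have hstd : stdNormalQuantile α = sInf A := by
    simp [stdNormalQuantile, normalQuantile, hA]
  have himage : {y : ℝ | α ≤ cdf (gaussianReal μ (σ ^ 2).toNNReal) y} =
      (fun x => μ + σ * x) '' A := by
    ext y
    simp only [mem_ofPred_eq, cdf_gaussianReal_eq hσ, mem_image, hA]
    constructor
    · intro h
      exact ⟨(y - μ) / σ, h, by field_simp; ring⟩
    · rintro ⟨x, hx, rfl⟩
      rwa [add_sub_cancel_left, mul_div_cancel_left₀ _ hσ.ne']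
  have hne : A.Nonempty :=
    (((tendsto_cdf_atTop (gaussianReal 0 1)).eventually (lt_mem_nhds hα.2)).exists).imp
      fun _ h => le_of_lt h
  have hbdd : BddBelow A := by
    obtain ⟨b, hb⟩ := ((tendsto_cdf_atBot (gaussianReal 0 1)).eventually
      (gt_mem_nhds hα.1)).exists
    refine ⟨b, fun x hx => ?_⟩
    by_contra! h
    exact absurd (hx.trans (monotone_cdf (gaussianReal 0 1) h.le)) (not_le.2 hb)
  rw [hstd, normalQuantile, himage]
  refine (Monotone.map_csInf_of_continuousAt (f := fun x => μ + σ * x) (by fun_prop) ?_ hne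
    hbdd).symm
  intro a b hab
  dsimp only
  gcongr

end Quantile

/-! ### Risk decomposition and optimality -/

section Risk

instance (J : ℕ) (G : Measure (ℝ × ℝ)) [IsProbabilityMeasure G] :
    IsMarkovKernel (posterior J G) := by
  unfold posterior; infer_instance

/-- Bias-variance decomposition of the mean squared error, without moment assumption. -/
theorem lintegral_ofReal_sub_sq_eq {Ω : Type*} [MeasurableSpace Ω] {π : Measure Ω}
    [IsProbabilityMeasure π] {q : Ω → ℝ} (hq : Integrable q π) (a : ℝ) :
    ∫⁻ ω, ENNReal.ofReal ((a - q ω) ^ 2) ∂π =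
      ∫⁻ ω, ENNReal.ofReal (((∫ x, q x ∂π) - q ω) ^ 2) ∂π +
        ENNReal.ofReal ((a - ∫ x, q x ∂π) ^ 2) := by
  set m := ∫ x, q x ∂π with hm
  -- Two such squares differ by an affine function of the integrable `q`, so square integrability
  -- does not depend on the centre; if it fails, both sides are `∞`.
  have hsq : ∀ b c : ℝ, Integrable (fun ω => (b - q ω) ^ 2) π →
      Integrable (fun ω => (c - q ω) ^ 2) π := fun b c h => by
    refine (h.add ((((integrable_const b).sub hq).const_mul (2 * (c - b))).add
      (integrable_const ((c - b) ^ 2)))).congr (ae_of_all _ fun ω => ?_)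
    simp only [Pi.add_apply, Pi.sub_apply]
    ring
  have hmeas : ∀ b : ℝ, AEStronglyMeasurable (fun ω => (b - q ω) ^ 2) π := fun b =>
    (aestronglyMeasurable_const.sub hq.aestronglyMeasurable).pow 2
  have htop : ∀ b : ℝ, ¬ Integrable (fun ω => (b - q ω) ^ 2) π →
      ∫⁻ ω, ENNReal.ofReal ((b - q ω) ^ 2) ∂π = ∞ := fun b h => by
    by_contra hne
    exact h ((lintegral_ofReal_ne_top_iff_integrable (hmeas b)
      (ae_of_all _ fun _ => sq_nonneg _)).1 hne)
  by_cases h : Integrable (fun ω => (m - q ω) ^ 2) π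
  · rw [← ofReal_integral_eq_lintegral_ofReal h (ae_of_all _ fun _ => sq_nonneg _),
      ← ofReal_integral_eq_lintegral_ofReal (hsq m a h) (ae_of_all _ fun _ => sq_nonneg _),
      ← ENNReal.ofReal_add (integral_nonneg fun _ => sq_nonneg _) (sq_nonneg _)]
    congr 1
    have e : ∀ ω, (a - q ω) ^ 2 = (m - q ω) ^ 2 + (2 * (a - m) * (m - q ω) + (a - m) ^ 2) :=
      fun ω => by ring
    simp_rw [e]
    have hmq : Integrable (fun ω => 2 * (a - m) * (m - q ω)) π :=
      ((integrable_const m).sub hq).const_mul _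
    have hsum : Integrable (fun ω => 2 * (a - m) * (m - q ω) + (a - m) ^ 2) π :=
      hmq.add (integrable_const _)
    rw [integral_add h hsum, integral_add hmq (integrable_const _),
      integral_const_mul, integral_sub (integrable_const m) hq, integral_const, integral_const,
      ← hm]
    simp
  · rw [htop m h, htop a fun h' => h (hsq a m h'), top_add]

variable {J : ℕ} {G : Measure (ℝ × ℝ)} [IsProbabilityMeasure G]

/-- Sufficiency in the form used for the risk: `F` may depend on the whole data vector, though the
posterior conditions only on mean and standard deviation. -/
theorem lintegral_posterior_unitLaw (hJ : 1 < J) (hG : ∀ᵐ θ ∂G, 0 < θ.2)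
    {F : (Fin J → ℝ) × (ℝ × ℝ) → ℝ≥0∞} (hF : Measurable F) :
    ∫⁻ ω, F (unitData ω.1 ω.2, ω.1) ∂(unitLaw J G) =
      ∫⁻ ω, ∫⁻ t, F (unitData ω.1 ω.2, t) ∂(posterior J G (meanSd (unitData ω.1 ω.2)))
        ∂(unitLaw J G) := by
  have := isFiniteKernel_bayesKernel hJ hG
  have hae := ae_of_ae_map (measurable_meanSd_unitData J).aemeasurable (ae_posterior_eq hJ hG)
  have hΦ : Measurable fun x : Fin J → ℝ => ∫⁻ t, F (x, t) ∂(bayesKernel J G (meanSd x)) :=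
    Measurable.lintegral_kernel_prod_right' (κ := (bayesKernel J G).comap meanSd
      (measurable_meanSd J)) hF
  have e : ∀ᵐ ω ∂(unitLaw J G),
      ∫⁻ t, F (unitData ω.1 ω.2, t) ∂(posterior J G (meanSd (unitData ω.1 ω.2))) =
        ∫⁻ t, F (unitData ω.1 ω.2, t) ∂(bayesKernel J G (meanSd (unitData ω.1 ω.2))) :=
    hae.mono fun ω hω => by rw [hω.2]
  rw [lintegral_congr_ae e, lintegral_unitLaw (hF.fun_comp ((measurable_unitData J).prodMk measurable_fst)),
    lintegral_bayesKernel hJ hG hF]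
  exact (lintegral_unitLaw (hΦ.fun_comp (measurable_unitData J))).symm

/-- Data of all units, as a function of the pairs (parameter, noise). -/
def observePairs {n J : ℕ} (W : Fin n → (ℝ × ℝ) × (Fin J → ℝ)) : Fin n → Fin J → ℝ :=
  fun i => unitData (W i).1 (W i).2

theorem measurable_observePairs (n J : ℕ) :
    Measurable (observePairs : (Fin n → (ℝ × ℝ) × (Fin J → ℝ)) → Fin n → Fin J → ℝ) :=
  measurable_pi_lambda _ fun i => (measurable_unitData J).fun_comp (measurable_pi_apply i)

theorem measurable_observe (n J : ℕ) :
    Measurable fun ω : (Fin n → ℝ × ℝ) × (Fin n → Fin J → ℝ) => observe ω.1 ω.2 := by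
  unfold observe unitData; fun_prop

theorem lintegral_paramLaw_noiseLaw (n : ℕ)
    {F : (Fin n → ℝ × ℝ) × (Fin n → Fin J → ℝ) → ℝ≥0∞} :
    ∫⁻ ω, F ω ∂((paramLaw n G).prod (noiseLaw n J)) =
      ∫⁻ W, F (fun i => (W i).1, fun i => (W i).2) ∂(Measure.pi fun _ : Fin n => unitLaw J G) :=
  ((measurePreserving_arrowProdEquivProdArrow (ℝ × ℝ) (Fin J → ℝ) (Fin n) (fun _ => G)
    fun _ => unitNoise J).lintegral_comp_emb (MeasurableEquiv.measurableEmbedding _) F).symm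

theorem measurePreserving_observePairs (n J : ℕ) (G : Measure (ℝ × ℝ)) [IsProbabilityMeasure G] :
    MeasurePreserving observePairs (Measure.pi fun _ : Fin n => unitLaw J G) (dataLaw n J G) := by
  refine ⟨measurable_observePairs n J, ?_⟩
  have h := (measurePreserving_arrowProdEquivProdArrow (ℝ × ℝ) (Fin J → ℝ) (Fin n) (fun _ => G)
    fun _ => unitNoise J).map_eq
  unfold dataLaw paramLaw noiseLaw
  rw [← h, Measure.map_map (measurable_observe n J) (MeasurableEquiv.measurable _)]
  rfl

instance (n J : ℕ) (G : Measure (ℝ × ℝ)) [IsProbabilityMeasure G] :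
    IsProbabilityMeasure (dataLaw n J G) := by
  rw [← (measurePreserving_observePairs n J G).map_eq]
  exact Measure.isProbabilityMeasure_map (measurable_observePairs n J).aemeasurable

theorem measurePreserving_meanSd_apply {n : ℕ} (i : Fin n) :
    MeasurePreserving (fun Y : Fin n → Fin J → ℝ => meanSd (Y i)) (dataLaw n J G)
      ((unitLaw J G).map fun ω => meanSd (unitData ω.1 ω.2)) := by
  have hm : Measurable fun Y : Fin n → Fin J → ℝ => meanSd (Y i) :=
    (measurable_meanSd J).fun_comp (measurable_pi_apply i)
  refine ⟨hm, ?_⟩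
  rw [← (measurePreserving_observePairs n J G).map_eq,
    Measure.map_map hm (measurable_observePairs n J)]
  conv_rhs => rw [← (measurePreserving_eval (fun _ : Fin n => unitLaw J G) i).map_eq,
    Measure.map_map (measurable_meanSd_unitData J) (measurable_pi_apply i)]
  rfl

/-- Given the data of all units, the parameter of unit `i` has the posterior law computed from
unit `i` alone. -/
theorem lintegral_posterior_dataLaw (hJ : 1 < J) (hG : ∀ᵐ θ ∂G, 0 < θ.2) {n : ℕ} (i : Fin n)
    {F : (Fin n → Fin J → ℝ) × (ℝ × ℝ) → ℝ≥0∞} (hF : Measurable F) :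
    ∫⁻ ω, F (observe ω.1 ω.2, ω.1 i) ∂((paramLaw n G).prod (noiseLaw n J)) =
      ∫⁻ Y, ∫⁻ t, F (Y, t) ∂(posterior J G (meanSd (Y i))) ∂(dataLaw n J G) := by
  obtain ⟨n, rfl⟩ : ∃ m, n = m + 1 := ⟨n - 1, by have := i.2; omega⟩
  have hΦ : Measurable fun Y : Fin (n + 1) → Fin J → ℝ =>
      ∫⁻ t, F (Y, t) ∂(posterior J G (meanSd (Y i))) :=
    Measurable.lintegral_kernel_prod_right' (κ := (posterior J G).comap
      (fun Y : Fin (n + 1) → Fin J → ℝ => meanSd (Y i))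
      (measurePreserving_meanSd_apply (G := G) i).measurable) hF
  have hsplit := (measurePreserving_piFinSuccAbove (fun _ : Fin (n + 1) => unitLaw J G) i).symm
  have hins : ∀ (ω : (ℝ × ℝ) × (Fin J → ℝ)) (W : Fin n → (ℝ × ℝ) × (Fin J → ℝ)),
      observePairs (i.insertNth ω W : Fin (n + 1) → (ℝ × ℝ) × (Fin J → ℝ)) =
        (i.insertNth (unitData ω.1 ω.2) (observePairs W) : Fin (n + 1) → Fin J → ℝ) := by
    intro ω W
    ext j : 1
    refine Fin.succAboveCases i ?_ (fun j => ?_) j <;> simp [observePairs]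
  have hinsm : Measurable fun p : (Fin J → ℝ) × (Fin n → Fin J → ℝ) =>
      (i.insertNth p.1 p.2 : Fin (n + 1) → Fin J → ℝ) :=
    (MeasurableEquiv.piFinSuccAbove (fun _ => Fin J → ℝ) i).symm.measurable
  rw [lintegral_paramLaw_noiseLaw (F := fun ω => F (observe ω.1 ω.2, ω.1 i)),
    ← (measurePreserving_observePairs (n + 1) J G).map_eq,
    lintegral_map hΦ (measurable_observePairs _ J),
    ← hsplit.lintegral_comp_emb (MeasurableEquiv.measurableEmbedding _),
    ← hsplit.lintegral_comp_emb (MeasurableEquiv.measurableEmbedding _)]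
  change ∫⁻ p : ((ℝ × ℝ) × (Fin J → ℝ)) × (Fin n → (ℝ × ℝ) × (Fin J → ℝ)), F (observePairs (i.insertNth p.1 p.2 : Fin (n + 1) → (ℝ × ℝ) × (Fin J → ℝ)),
      (i.insertNth p.1 p.2 : Fin (n + 1) → (ℝ × ℝ) × (Fin J → ℝ)) i |>.1) ∂_ =
    ∫⁻ p : ((ℝ × ℝ) × (Fin J → ℝ)) × (Fin n → (ℝ × ℝ) × (Fin J → ℝ)), ∫⁻ t, F (observePairs (i.insertNth p.1 p.2 : Fin (n + 1) → (ℝ × ℝ) × (Fin J → ℝ)), t)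
      ∂(posterior J G (meanSd (observePairs
        (i.insertNth p.1 p.2 : Fin (n + 1) → (ℝ × ℝ) × (Fin J → ℝ)) i))) ∂_
  simp_rw [hins, Fin.insertNth_apply_same]
  have hD : Measurable fun p : ((ℝ × ℝ) × (Fin J → ℝ)) × (Fin n → (ℝ × ℝ) × (Fin J → ℝ)) =>
      (i.insertNth (unitData p.1.1 p.1.2) (observePairs p.2) : Fin (n + 1) → Fin J → ℝ) :=
    hinsm.fun_comp (((measurable_unitData J).fun_comp measurable_fst).prodMk
      ((measurable_observePairs n J).fun_comp measurable_snd))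
  have hm1 : Measurable fun p : ((ℝ × ℝ) × (Fin J → ℝ)) × (Fin n → (ℝ × ℝ) × (Fin J → ℝ)) =>
      F (i.insertNth (unitData p.1.1 p.1.2) (observePairs p.2), p.1.1) :=
    hF.fun_comp (hD.prodMk (measurable_fst.fun_comp measurable_fst))
  have hm2 : Measurable fun p : ((ℝ × ℝ) × (Fin J → ℝ)) × (Fin n → (ℝ × ℝ) × (Fin J → ℝ)) =>
      ∫⁻ t, F (i.insertNth (unitData p.1.1 p.1.2) (observePairs p.2), t)
        ∂(posterior J G (meanSd (unitData p.1.1 p.1.2))) := by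
    have := hΦ.fun_comp hD
    simpa only [Fin.insertNth_apply_same] using this
  -- The other units are put in the outer integral; with them frozen, the identity for one unit
  -- applies.
  rw [lintegral_prod_symm _ hm1.aemeasurable, lintegral_prod_symm _ hm2.aemeasurable]
  refine lintegral_congr fun W => ?_
  exact lintegral_posterior_unitLaw hJ hG
    (F := fun p => F (i.insertNth p.1 (observePairs W), p.2))
    (hF.fun_comp ((hinsm.fun_comp (measurable_fst.prodMk measurable_const)).prodMk measurable_snd))

theorem measurable_postQuantile (J : ℕ) (G : Measure (ℝ × ℝ)) [IsProbabilityMeasure G] (α : ℝ) :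
    Measurable fun t : ℝ × ℝ => postQuantile J G α t.1 t.2 := by
  have h1 : Measurable fun t : ℝ × ℝ => postMean J G t.1 t.2 :=
    (StronglyMeasurable.integral_kernel (κ := posterior J G)
      (measurable_fst.stronglyMeasurable (f := fun θ : ℝ × ℝ => θ.1))).measurable
  have h2 : Measurable fun t : ℝ × ℝ => postSd J G t.1 t.2 :=
    (StronglyMeasurable.integral_kernel (κ := posterior J G)
      (measurable_snd.stronglyMeasurable (f := fun θ : ℝ × ℝ => θ.2))).measurable
  exact h1.add (h2.mul_const _)

theorem measurable_oracleQuantile (n J : ℕ) (G : Measure (ℝ × ℝ)) [IsProbabilityMeasure G]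
    (α : ℝ) : Measurable (oracleQuantile n J G α) :=
  measurable_pi_lambda _ fun i => (measurable_postQuantile J G α).fun_comp
    ((measurable_meanSd J).fun_comp (measurable_pi_apply i))

theorem ae_integrable_posterior (hJ : 1 < J) (hG : ∀ᵐ θ ∂G, 0 < θ.2) :
    ∀ᵐ t ∂((unitLaw J G).map fun ω => meanSd (unitData ω.1 ω.2)),
      Integrable (fun θ : ℝ × ℝ => θ.1) (posterior J G t) ∧
        Integrable (fun θ : ℝ × ℝ => θ.2) (posterior J G t) := by
  filter_upwards [ae_posterior_eq hJ hG] with t ht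
  rw [ht.2]
  exact ⟨integrable_bayesKernel hJ hG t
      (integrable_fst_mul_samplingDensity hJ hG (pow_pos ht.1 2) t.1),
    integrable_bayesKernel hJ hG t
      (integrable_snd_mul_samplingDensity hJ hG (pow_pos ht.1 2) t.1)⟩

/-- Mean squared error of one coordinate of an estimator. -/
theorem lintegral_sq_eq_add (hJ : 1 < J) (hG : ∀ᵐ θ ∂G, 0 < θ.2) (α : ℝ) {n : ℕ} (i : Fin n)
    {est : (Fin n → Fin J → ℝ) → Fin n → ℝ} (hest : Measurable est) :
    ∫⁻ ω, ENNReal.ofReal ((est (observe ω.1 ω.2) i -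
        ((ω.1 i).1 + (ω.1 i).2 * stdNormalQuantile α)) ^ 2) ∂((paramLaw n G).prod (noiseLaw n J)) =
      ∫⁻ Y, ∫⁻ t, ENNReal.ofReal ((oracleQuantile n J G α Y i -
          (t.1 + t.2 * stdNormalQuantile α)) ^ 2) ∂(posterior J G (meanSd (Y i)))
          ∂(dataLaw n J G) +
        ∫⁻ Y, ENNReal.ofReal ((est Y i - oracleQuantile n J G α Y i) ^ 2) ∂(dataLaw n J G) := by
  have hei : Measurable fun Y => est Y i := (measurable_pi_apply i).fun_comp hest
  have hoi : Measurable fun Y => oracleQuantile n J G α Y i :=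
    (measurable_pi_apply i).fun_comp (measurable_oracleQuantile n J G α)
  have hF : Measurable fun p : (Fin n → Fin J → ℝ) × (ℝ × ℝ) =>
      ENNReal.ofReal ((est p.1 i - (p.2.1 + p.2.2 * stdNormalQuantile α)) ^ 2) := by
    have h : Measurable fun p : (Fin n → Fin J → ℝ) × (ℝ × ℝ) => est p.1 i :=
      hei.fun_comp measurable_fst
    exact ((h.sub (by fun_prop)).pow_const 2).ennreal_ofReal
  rw [lintegral_posterior_dataLaw hJ hG i hF, ← lintegral_add_right _ (by fun_prop)]
  refine lintegral_congr_ae ?_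
  filter_upwards [(measurePreserving_meanSd_apply i).quasiMeasurePreserving.ae
    (ae_integrable_posterior hJ hG)] with Y hY
  have e : oracleQuantile n J G α Y i =
      ∫ t : ℝ × ℝ, (t.1 + t.2 * stdNormalQuantile α) ∂(posterior J G (meanSd (Y i))) := by
    rw [integral_add hY.1 (hY.2.mul_const _), integral_mul_const]
    rfl
  rw [e]
  exact lintegral_ofReal_sub_sq_eq (hY.1.add (hY.2.mul_const _)) _

theorem risk_eq_sum {α : ℝ} (hα : α ∈ Ioo (0 : ℝ) 1) (hG : ∀ᵐ θ ∂G, 0 < θ.2) {n : ℕ}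
    {est : (Fin n → Fin J → ℝ) → Fin n → ℝ} (hest : Measurable est) :
    risk G α est = ENNReal.ofReal (1 / n) * ∑ i, ∫⁻ ω, ENNReal.ofReal ((est (observe ω.1 ω.2) i -
        ((ω.1 i).1 + (ω.1 i).2 * stdNormalQuantile α)) ^ 2)
          ∂((paramLaw n G).prod (noiseLaw n J)) := by
  have : IsProbabilityMeasure (paramLaw n G) := by unfold paramLaw; infer_instance
  have : IsProbabilityMeasure (noiseLaw n J) := by unfold noiseLaw; infer_instance
  have hm : ∀ i, Measurable fun ω : (Fin n → ℝ × ℝ) × (Fin n → Fin J → ℝ) =>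
      ENNReal.ofReal ((est (observe ω.1 ω.2) i -
        ((ω.1 i).1 + (ω.1 i).2 * stdNormalQuantile α)) ^ 2) := fun i => by
    have h1 : Measurable fun ω : (Fin n → ℝ × ℝ) × (Fin n → Fin J → ℝ) =>
        est (observe ω.1 ω.2) i :=
      (measurable_pi_apply i).fun_comp (hest.fun_comp (measurable_observe n J))
    exact ((h1.sub (by fun_prop)).pow_const 2).ennreal_ofReal
  have hpos : ∀ᵐ θ ∂(paramLaw n G), ∀ i, 0 < (θ i).2 :=
    ae_all_iff.2 fun i => (measurePreserving_eval (fun _ : Fin n => G) i).quasiMeasurePreserving.ae hG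
  have e : ∀ᵐ θ ∂(paramLaw n G), ∫⁻ ε, ENNReal.ofReal
      (loss (est (observe θ ε)) fun i => normalQuantile (θ i).1 (θ i).2 α) ∂(noiseLaw n J) =
      ∫⁻ ε, ENNReal.ofReal (1 / n) * ∑ i, ENNReal.ofReal ((est (observe θ ε) i -
        ((θ i).1 + (θ i).2 * stdNormalQuantile α)) ^ 2) ∂(noiseLaw n J) := by
    filter_upwards [hpos] with θ hθ
    refine lintegral_congr fun ε => ?_
    rw [loss, ENNReal.ofReal_mul (by positivity),
      ENNReal.ofReal_sum_of_nonneg fun _ _ => sq_nonneg _]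
    simp_rw [fun i => normalQuantile_eq hα (θ i).1 (hθ i)]
  rw [risk, lintegral_congr_ae e, ← lintegral_finsetSum _ fun i _ => hm i,
    ← lintegral_const_mul _ (Finset.measurable_sum _ fun i _ => hm i)]
  exact (lintegral_prod _ ((Finset.measurable_sum _ fun i _ => hm i).const_mul _).aemeasurable).symm

/-- The excess risk over the oracle is the mean squared distance to the oracle. -/
theorem risk_eq_risk_oracle_add (hJ : 1 < J) {α : ℝ} (hα : α ∈ Ioo (0 : ℝ) 1)
    (hG : ∀ᵐ θ ∂G, 0 < θ.2) {n : ℕ} {est : (Fin n → Fin J → ℝ) → Fin n → ℝ}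
    (hest : Measurable est) :
    risk G α est = risk G α (oracleQuantile n J G α) + ENNReal.ofReal (1 / n) *
      ∑ i, ∫⁻ Y, ENNReal.ofReal ((est Y i - oracleQuantile n J G α Y i) ^ 2) ∂(dataLaw n J G) := by
  rw [risk_eq_sum hα hG hest, risk_eq_sum hα hG (measurable_oracleQuantile n J G α)]
  -- The same decomposition is applied to the oracle, whose distance to itself vanishes.
  simp_rw [fun i => lintegral_sq_eq_add hJ hG α i hest,
    fun i => lintegral_sq_eq_add hJ hG α i (measurable_oracleQuantile n J G α)]
  simp [Finset.sum_add_distrib, mul_add]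

theorem isRiskMinimizer_oracleQuantile (hJ : 1 < J) {α : ℝ} (hα : α ∈ Ioo (0 : ℝ) 1)
    (hG : ∀ᵐ θ ∂G, 0 < θ.2) (n : ℕ) : IsRiskMinimizer G α (oracleQuantile n J G α) :=
  ⟨measurable_oracleQuantile n J G α, fun est hest => by
    rw [risk_eq_risk_oracle_add hJ hα hG hest]
    exact le_self_add⟩

theorem IsRiskMinimizer.ae_eq_oracleQuantile (hJ : 1 < J) {α : ℝ} (hα : α ∈ Ioo (0 : ℝ) 1)
    (hG : ∀ᵐ θ ∂G, 0 < θ.2) {n : ℕ} {est : (Fin n → Fin J → ℝ) → Fin n → ℝ}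
    (hest : IsRiskMinimizer G α est) (hfin : risk G α est ≠ ⊤) :
    est =ᵐ[dataLaw n J G] oracleQuantile n J G α := by
  have h1 := risk_eq_risk_oracle_add hJ hα hG hest.1
  have h2 := hest.2 _ (measurable_oracleQuantile n J G α)
  have hne : risk G α (oracleQuantile n J G α) ≠ ⊤ :=
    ne_top_of_le_ne_top hfin ((isRiskMinimizer_oracleQuantile hJ hα hG n).2 est hest.1)
  -- Finiteness of the oracle risk permits cancelling it, so minimality forces the excess term to be
  -- zero.
  have h3 := mul_eq_zero.1 (nonpos_iff_eq_zero.1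
    ((ENNReal.add_le_add_iff_left hne).1 ((h1 ▸ h2).trans_eq (add_zero _).symm)))
  have h4 : ∀ i, ∀ᵐ Y ∂(dataLaw n J G), est Y i = oracleQuantile n J G α Y i := fun i => by
    -- An index `i` exists here, so `1/n` is nonzero; for `n = 0` there is nothing to show.
    have hn : (0 : ℝ) < n := by exact_mod_cast i.pos
    have h5 := Finset.sum_eq_zero_iff.1
      (h3.resolve_left (ENNReal.ofReal_pos.2 (by positivity)).ne') i (Finset.mem_univ i)
    have hei : Measurable fun Y => est Y i := (measurable_pi_apply i).fun_comp hest.1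
    have hoi : Measurable fun Y => oracleQuantile n J G α Y i :=
      (measurable_pi_apply i).fun_comp (measurable_oracleQuantile n J G α)
    rw [lintegral_eq_zero_iff (by fun_prop)] at h5
    filter_upwards [h5] with Y hY
    have hY' : (est Y i - oracleQuantile n J G α Y i) ^ 2 ≤ 0 := ENNReal.ofReal_eq_zero.1 hY
    exact sub_eq_zero.1 (pow_eq_zero_iff two_ne_zero |>.1 (le_antisymm hY' (sq_nonneg _)))
  filter_upwards [ae_all_iff.2 h4] with Y hY
  exact funext hY

theorem postQuantile_ae_eq_tweedieQuantile (hJ : 2 < J) (α : ℝ) (hG : ∀ᵐ θ ∂G, 0 < θ.2) :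
    ∀ᵐ p : ℝ × ℝ, 0 < p.2 → postQuantile J G α p.1 p.2 =
      tweedieQuantile J α (mixtureDensity J G) p.1 (p.2 ^ 2) := by
  have hJ' : 1 < J := by omega
  filter_upwards [ae_volume_of_ae_map_meanSd hJ' hG (ae_posterior_eq hJ' hG)] with p hp hp0
  have h := (hp hp0).2
  rw [postQuantile, postMean, postSd, h, integral_bayesKernel hJ' hG, integral_bayesKernel hJ' hG,
    tweedieQuantile, tweedieMean_mixtureDensity hJ hG (pow_pos hp0 2),
    (tweedieSd_mixtureDensity hJ' hG (pow_pos hp0 2) p.1).2]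

end Risk

end HeteroEB

theorem mainTheorem3 (J : ℕ) (hJ : 3 < J) (α : ℝ) (hα : α ∈ Set.Ioo (0 : ℝ) 1)
    (G : MeasureTheory.Measure (ℝ × ℝ)) [MeasureTheory.IsProbabilityMeasure G]
    (hG : ∀ᵐ θ ∂G, 0 < θ.2) :
    -- the `α`-quantile of `N(μ, σ²)` is `μ + σ Φ⁻¹(α)`
    (∀ μ σ : ℝ, 0 < σ →
      HeteroEB.normalQuantile μ σ α = μ + σ * HeteroEB.stdNormalQuantile α) ∧
    -- the posterior means of `μ` and `σ` exist
    (∀ᵐ p : ℝ × ℝ, 0 < p.2 →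
      MeasureTheory.Integrable (fun θ : ℝ × ℝ => θ.1) (HeteroEB.posterior J G p) ∧
      MeasureTheory.Integrable (fun θ : ℝ × ℝ => θ.2) (HeteroEB.posterior J G p)) ∧
    -- the posterior quantile estimator minimizes the risk, and it is the only minimizer (up to
    -- almost sure equality) whenever the minimal risk is finite
    (∀ n : ℕ,
      HeteroEB.IsRiskMinimizer G α (HeteroEB.oracleQuantile n J G α) ∧
      ∀ est : (Fin n → Fin J → ℝ) → Fin n → ℝ,
        HeteroEB.IsRiskMinimizer G α est → HeteroEB.risk G α est ≠ ⊤ →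
        est =ᵐ[HeteroEB.dataLaw n J G] HeteroEB.oracleQuantile n J G α) ∧
    -- `f_G` is the density of (sample mean, sample variance)
    (HeteroEB.unitLaw J G).map
        (fun ω => (HeteroEB.sampleMean (HeteroEB.unitData ω.1 ω.2),
          HeteroEB.sampleVar (HeteroEB.unitData ω.1 ω.2))) =
      MeasureTheory.volume.withDensity
        (fun p : ℝ × ℝ => ENNReal.ofReal (HeteroEB.mixtureDensity J G p.1 p.2)) ∧
    -- the estimator is an explicit functional of `f_G`
    HeteroEB.TweedieWellDefined J (HeteroEB.mixtureDensity J G) ∧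
    (∀ᵐ p : ℝ × ℝ, 0 < p.2 →
      HeteroEB.postQuantile J G α p.1 p.2 =
        HeteroEB.tweedieQuantile J α (HeteroEB.mixtureDensity J G) p.1 (p.2 ^ 2)) ∧
    -- hence it depends on `G` only through `f_G`
    (∀ (G' : MeasureTheory.Measure (ℝ × ℝ)) [MeasureTheory.IsProbabilityMeasure G'],
      (∀ᵐ θ ∂G', 0 < θ.2) →
      (∀ y v : ℝ, 0 < v →
        HeteroEB.mixtureDensity J G y v = HeteroEB.mixtureDensity J G' y v) →
      ∀ᵐ p : ℝ × ℝ, 0 < p.2 →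
        HeteroEB.postQuantile J G α p.1 p.2 = HeteroEB.postQuantile J G' α p.1 p.2) := by
  have hJ1 : 1 < J := by omega
  have hJ2 : 2 < J := by omega
  refine ⟨fun μ σ hσ => HeteroEB.normalQuantile_eq hα μ hσ,
    HeteroEB.ae_volume_of_ae_map_meanSd hJ1 hG (HeteroEB.ae_integrable_posterior hJ1 hG),
    fun n => ⟨HeteroEB.isRiskMinimizer_oracleQuantile hJ1 hα hG n,
      fun est hest hfin => hest.ae_eq_oracleQuantile hJ1 hα hG hfin⟩,
    HeteroEB.map_meanVar_unitLaw hJ1 hG,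
    HeteroEB.tweedieWellDefined_mixtureDensity hJ2 hG,
    HeteroEB.postQuantile_ae_eq_tweedieQuantile hJ2 α hG, ?_⟩
  intro G' _ hG' hGG'
  filter_upwards [HeteroEB.postQuantile_ae_eq_tweedieQuantile hJ2 α hG,
    HeteroEB.postQuantile_ae_eq_tweedieQuantile hJ2 α hG'] with p h h' hp
  rw [h hp, h' hp]
  exact HeteroEB.tweedieQuantile_congr hGG' p.1 (pow_pos hp 2)
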